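/- A signed permutation of $\{1,\dots,n\}$ is a list $\alpha=[a_1,\dots,a_n]$ of integers such that $|a_1|,\dots,|a_n|$ is a permutation of $1,\dots,n$. For $1\le i<n$ the pointer $(i,i+1)$ occurs twice in $\alpha$: next to the entry $\pm i$ (on its right if the entry is $i$, on its left if it is $-i$), and next to the entry $\pm(i+1)$ (on its left if the entry is $i+1$, on its right if it is $-(i+1)$). If these two entries have the same sign, then $\mathrm{cdr}_{(i,i+1)}(\alpha)=\alpha$; otherwise $\mathrm{cdr}_{(i,i+1)}$ is applicable, and it reverses the order and changes the signs of all entries between the two occurrences of the pointer. A cdr fixed point is a signed permutation fixed by all $\mathrm{cdr}_p$. A maximal sequence of cdr moves from $\alpha$ is a finite sequence of successively applicable operations $\mathrm{cdr}_p$, starting from $\alpha$, that ends in a cdr fixed point. In the cdr game on $\alpha$, players ONE and TWO, ONE first, alternately apply an applicable $\mathrm{cdr}_p$ until a cdr fixed point is reached. In the normal play game a player who cannot move loses (so the player making the last move wins); in the misère game a player who cannot move wins (so the player making the last move loses). **Theorem (the cdr Parity Theorem).** 1. For every signed permutation $\alpha$, all maximal sequences of cdr moves from $\alpha$ have lengths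 of the same parity. 2. Consequently both games are decided by playing out a single game. Every signed permutation $\alpha$ of $\{1,\dots,n\}$ has a maximal sequence of cdr moves, each such sequence has length at most $n-1$ (at most $0$ if $n=0$), and, if $k$ is the length of any one of them: in the normal play game ONE has a winning strategy if and only if $k$ is odd, and TWO has one if and only if $k$ is even; in the misère game ONE has a winning strategy if and only if $k$ is even, and TWO has one if and only if $k$ is odd. 3. The decision problems "given a signed permutation $\alpha$, does ONE have a winning strategy in the normal play cdr game on $\alpha$?" and "given a signed permutation $\alpha$, does ONE have a winning strategy in the misère cdr game on $\alpha$?" are decidable in linear time: each is answered by a fixed program for a random access machine with addition, subtraction and indirect addressing which, for some constant $C$, takes at most $C(n+1)$ steps on every signed permutation of $\{1,\dots,n\}$ and uses only integers of absolute value at most $C(n+1)$. -/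

import Mathlib

/-! ### Signed permutations, pointers and context directed reversals -/

/-- A signed permutation `[a₁, …, aₙ]` of `{1, …, n}`, in one-line notation: a list of integers
whose absolute values are `1, …, n`, each occurring exactly once. -/
@[ext]
structure SignedPerm (n : ℕ) where
  word : List ℤ
  perm : (word.map Int.natAbs).Perm (List.range' 1 n)

/-- The pointers `(i, i+1)` occurring twice in a signed permutation of `{1, …, n}`, given by their
first coordinate `i`, where `1 ≤ i` and `i + 1 ≤ n`. -/
abbrev Pointer (n : ℕ) : Type := {i : ℕ // 1 ≤ i ∧ i + 1 ≤ n}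

/-- Place (number of entries to its left) of the pointer `(i, i+1)` at the entry `±i`, of which it
is the head: the head is on the right of `i` and on the left of `-i`. -/
def headGap (i : ℕ) (w : List ℤ) : ℕ :=
  if (i : ℤ) ∈ w then w.idxOf (i : ℤ) + 1 else w.idxOf (-(i : ℤ))

/-- Place (number of entries to its left) of the pointer `(i, i+1)` at the entry `±(i+1)`, of which
it is the tail: the tail is on the left of `i+1` and on the right of `-(i+1)`. -/
def tailGap (i : ℕ) (w : List ℤ) : ℕ :=
  if (i : ℤ) + 1 ∈ w then w.idxOf ((i : ℤ) + 1) else w.idxOf (-((i : ℤ) + 1)) + 1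

/-- Reverse the order, and change the signs, of the entries between the places `g ≤ h`. -/
def reverseBetween (g h : ℕ) (w : List ℤ) : List ℤ :=
  w.take g ++ (((w.drop g).take (h - g)).reverse.map (fun x => -x) ++ (w.drop g).drop (h - g))

theorem reverseBetween_perm (g h : ℕ) (w : List ℤ) :
    ((reverseBetween g h w).map Int.natAbs).Perm (w.map Int.natAbs) := by
  have e : w.map Int.natAbs = (w.take g).map Int.natAbs ++
      (((w.drop g).take (h - g)).map Int.natAbs ++ ((w.drop g).drop (h - g)).map Int.natAbs) := by
    rw [← List.map_append, List.take_append_drop, ← List.map_append, List.take_append_drop]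
  rw [e, reverseBetween, List.map_append, List.map_append, List.map_map]
  refine List.Perm.append_left _ (List.Perm.append_right _ ?_)
  have : (Int.natAbs ∘ fun x : ℤ => -x) = Int.natAbs := by
    funext x
    simp
  rw [this]
  exact (List.reverse_perm _).map _

namespace SignedPerm

variable {n : ℕ}

/-- The pointer `p = (i, i+1)` is oriented in `α`: its two entries `±i` and `±(i+1)` have opposite
signs. These are the pointers at which a context directed reversal is applicable. -/
def Oriented (α : SignedPerm n) (p : Pointer n) : Prop :=
  ∃ x ∈ α.word, ∃ y ∈ α.word, x.natAbs = p.1 ∧ y.natAbs = p.1 + 1 ∧ x * y < 0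

instance (α : SignedPerm n) (p : Pointer n) : Decidable (α.Oriented p) := by
  unfold Oriented
  infer_instance

/-- The context directed reversal at the pointer `p`. If the two entries of `p` have the same sign,
nothing changes. Otherwise all the entries between the two occurrences of `p` are reversed and
change their signs. -/
def cdr (p : Pointer n) (α : SignedPerm n) : SignedPerm n :=
  if α.Oriented p then
    { word := reverseBetween (min (headGap p.1 α.word) (tailGap p.1 α.word))
        (max (headGap p.1 α.word) (tailGap p.1 α.word)) α.word
      perm := (reverseBetween_perm _ _ _).trans α.perm }
  else α

/-- A fixed point of the operation cdr. -/
def IsCdrFixedPoint (α : SignedPerm n) : Prop :=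
  ∀ p : Pointer n, α.cdr p = α

/-- `ps = [p₁, …, pₖ]` is a maximal sequence of cdr moves from `α`: cdr is applicable successively
at `p₁, …, pₖ`, and a cdr fixed point is reached. Equivalently, `ps` is a complete play of the cdr
game on `α`. -/
def IsMaximalCdrSeq : SignedPerm n → List (Pointer n) → Prop
  | α, [] => α.IsCdrFixedPoint
  | α, p :: ps => α.Oriented p ∧ IsMaximalCdrSeq (α.cdr p) ps

/-! ### The two-player games -/

mutual

/-- In the normal play cdr game at position `α`, the player to move has a winning strategy. -/
inductive NormalMoverWins : SignedPerm n → Prop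
  | move (α : SignedPerm n) (p : Pointer n) (hp : α.Oriented p)
      (h : NormalOtherWins (α.cdr p)) : NormalMoverWins α

/-- In the normal play cdr game at position `α`, the player who is not to move has a winning
strategy; in particular, he wins when no legal move is left. -/
inductive NormalOtherWins : SignedPerm n → Prop
  | reply (α : SignedPerm n)
      (h : ∀ p : Pointer n, α.Oriented p → NormalMoverWins (α.cdr p)) : NormalOtherWins α

end

mutual

/-- In the misère cdr game at position `α`, the player to move has a winning strategy; in
particular, he wins when no legal move is left. -/
inductive MisereMoverWins : SignedPerm n → Prop
  | stuck (α : SignedPerm n) (h : ∀ p : Pointer n, ¬ α.Oriented p) : MisereMoverWins α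
  | move (α : SignedPerm n) (p : Pointer n) (hp : α.Oriented p)
      (h : MisereOtherWins (α.cdr p)) : MisereMoverWins α

/-- In the misère cdr game at position `α`, the player who is not to move has a winning
strategy. -/
inductive MisereOtherWins : SignedPerm n → Prop
  | reply (α : SignedPerm n) (hm : ∃ p : Pointer n, α.Oriented p)
      (h : ∀ p : Pointer n, α.Oriented p → MisereMoverWins (α.cdr p)) : MisereOtherWins α

end

/-- Player ONE, who moves first, has a winning strategy in the normal play game `N(α, cdr)`. -/
def OneWinsNormal (α : SignedPerm n) : Prop := NormalMoverWins α

/-- Player TWO has a winning strategy in the normal play game `N(α, cdr)`. -/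
def TwoWinsNormal (α : SignedPerm n) : Prop := NormalOtherWins α

/-- Player ONE, who moves first, has a winning strategy in the misère game `M(α, cdr)`. -/
def OneWinsMisere (α : SignedPerm n) : Prop := MisereMoverWins α

/-- Player TWO has a winning strategy in the misère game `M(α, cdr)`. -/
def TwoWinsMisere (α : SignedPerm n) : Prop := MisereOtherWins α

end SignedPerm

/-! ### Random access machines with a step count -/

namespace RAM

/-- The state of a random access machine: the contents of its registers and of its memory. -/
structure State where
  reg : ℕ → ℤ
  mem : ℕ → ℤ

/-- Write `v` into register `x`. -/
def State.setReg (s : State) (x : ℕ) (v : ℤ) : State := ⟨Function.update s.reg x v, s.mem⟩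

/-- Write `v` into the memory cell with address `a`. -/
def State.setMem (s : State) (a : ℕ) (v : ℤ) : State := ⟨s.reg, Function.update s.mem a v⟩

/-- Programs: registers are set to constants, to sums and to differences of registers; memory is
read and written at an address held in a register; control depends on whether a register is
positive. A program mentions finitely many registers. -/
inductive Prog
  | const (x : ℕ) (c : ℤ)
  | add (x y z : ℕ)
  | sub (x y z : ℕ)
  | load (x y : ℕ)
  | store (x y : ℕ)
  | seq (P Q : Prog)
  | ifPos (x : ℕ) (P Q : Prog)
  | whilePos (x : ℕ) (P : Prog)

/-- `Exec W P s t s'`: on a machine whose words hold the integers of absolute value at most `W`,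
the program `P`, started in the state `s`, halts in the state `s'` after exactly `t` steps. Each
elementary instruction and each test is one step; there is no execution in which a word
overflows or an address is negative. -/
inductive Exec (W : ℕ) : Prog → State → ℕ → State → Prop
  | const (s : State) (x : ℕ) (c : ℤ) (hc : |c| ≤ (W : ℤ)) :
      Exec W (.const x c) s 1 (s.setReg x c)
  | add (s : State) (x y z : ℕ) (h : |s.reg y + s.reg z| ≤ (W : ℤ)) :
      Exec W (.add x y z) s 1 (s.setReg x (s.reg y + s.reg z))
  | sub (s : State) (x y z : ℕ) (h : |s.reg y - s.reg z| ≤ (W : ℤ)) :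
      Exec W (.sub x y z) s 1 (s.setReg x (s.reg y - s.reg z))
  | load (s : State) (x y : ℕ) (h : 0 ≤ s.reg y) :
      Exec W (.load x y) s 1 (s.setReg x (s.mem (s.reg y).toNat))
  | store (s : State) (x y : ℕ) (h : 0 ≤ s.reg x) :
      Exec W (.store x y) s 1 (s.setMem (s.reg x).toNat (s.reg y))
  | seq (P Q : Prog) (s s' s'' : State) (t t' : ℕ) (hP : Exec W P s t s')
      (hQ : Exec W Q s' t' s'') : Exec W (.seq P Q) s (t + t') s''
  | ifPos_true (x : ℕ) (P Q : Prog) (s s' : State) (t : ℕ) (h : 0 < s.reg x)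
      (hP : Exec W P s t s') : Exec W (.ifPos x P Q) s (t + 1) s'
  | ifPos_false (x : ℕ) (P Q : Prog) (s s' : State) (t : ℕ) (h : ¬ 0 < s.reg x)
      (hQ : Exec W Q s t s') : Exec W (.ifPos x P Q) s (t + 1) s'
  | while_true (x : ℕ) (P : Prog) (s s' s'' : State) (t t' : ℕ) (h : 0 < s.reg x)
      (hP : Exec W P s t s') (hW : Exec W (.whilePos x P) s' t' s'') :
      Exec W (.whilePos x P) s (t + t' + 1) s''
  | while_false (x : ℕ) (P : Prog) (s : State) (h : ¬ 0 < s.reg x) :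
      Exec W (.whilePos x P) s 1 s

/-- The initial state on the input `α = [a₁, …, aₙ]`: register `0` holds `n`, the memory cells
`1, …, n` hold `a₁, …, aₙ`, and everything else is `0`. -/
def input {n : ℕ} (α : SignedPerm n) : State where
  reg := fun x => if x = 0 then (n : ℤ) else 0
  mem := fun a => if a = 0 then 0 else α.word.getD (a - 1) 0

/-- The decision problem `Q` about signed permutations is decidable in linear time: a single
program answers it (by `1` for yes and `0` for no in register `0`) in at most `C * (n + 1)` steps
on every signed permutation of length `n`, using only words of absolute value at most
`C * (n + 1)`, that is, words of `O(log n)` bits. -/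
def LinearTimeDecidable (Q : ∀ n : ℕ, SignedPerm n → Prop) : Prop :=
  ∃ (P : Prog) (C : ℕ), ∀ (n : ℕ) (α : SignedPerm n), ∃ (t : ℕ) (s : State),
    Exec (C * (n + 1)) P (input α) t s ∧ t ≤ C * (n + 1) ∧
      (Q n α ∧ s.reg 0 = 1 ∨ ¬ Q n α ∧ s.reg 0 = 0)

end RAM

-- Close the word up into a cycle, and let the label `x` stand for the right side of an entry `x`
-- and the label `-x` for its left side. An adjacency of `x` and its successor `y` becomes an edge
-- `{x, -y}`, and the matching formed by these edges is the same when the word is read backwards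
-- with all signs changed. The pointer `(i, i+1)` is the pair of labels `i`, `-(i+1)`. An applicable
-- cdr cuts the edges at these two labels and rejoins the ends, so that the two labels become
-- partners and so do their former partners (`matching_cdr`, from `matching_reversal`).
--
-- Such a recombination makes sense for every matching and every pointer, whether or not a cdr
-- applies. Recombinations at disjoint pairs commute (`recombine_recombine`), and when all pointers
-- are processed in turn, the number of those whose edge is still missing at their turn does not
-- depend on the order (`sortDist_perm`). Call this number `dist`; it is at most the number of
-- pointers. Processing `p` first shows that each cdr move lowers it by exactly one (`dist_cdr`).
--
-- At a fixed point `dist` may be positive, but it is even (`even_dist`). All signs agree there, and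
-- reading backwards if necessary makes them positive. Each recombination then multiplies the
-- successor permutation by a transposition, trivial exactly when the edge is already present
-- (`exists_sort`). Since the process leads from one `n`-cycle to another, the number of nontrivial
-- factors is even (`even_sortDist_of_pos`). Hence the length of every play has the parity of
-- `dist`, which settles both games. Finally, `dist` modulo 2 is found in linear time by carrying
-- out the recombinations on a table of the matching, each with boundedly many memory accesses.

-- Matchings of signed labels and their recombinations.

/-- The matching `x ↦ -c x`, `-c x ↦ x` on signed labels induced by a successor permutation `c`. -/
def matching (c : Equiv.Perm ℤ) : Equiv.Perm ℤ :=
  Equiv.neg ℤ * c * Equiv.neg ℤ * c⁻¹ * Equiv.neg ℤ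

theorem matching_apply (c : Equiv.Perm ℤ) (x : ℤ) : matching c x = -c (-(c⁻¹ (-x))) := rfl

theorem matching_matching (c : Equiv.Perm ℤ) (x : ℤ) : matching c (matching c x) = x := by
  simp [matching_apply]

/-- A fixed point free involution of the nonzero integers. -/
structure IsMatching (B : Equiv.Perm ℤ) : Prop where
  invol : ∀ x, B (B x) = x
  fix : ∀ x, B x = x → x = 0
  zero : B 0 = 0

theorem isMatching_matching {c : Equiv.Perm ℤ} (h : c 0 = 0) : IsMatching (matching c) where
  invol := matching_matching c
  fix x hx := by
    rw [matching_apply, neg_eq_iff_eq_neg] at hx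
    have h2 : -(c⁻¹ (-x)) = c⁻¹ (-x) := Equiv.Perm.eq_inv_iff_eq.2 hx
    have h3 : c⁻¹ (-x) = 0 := by omega
    rw [Equiv.Perm.inv_eq_iff_eq, h] at h3
    omega
  zero := by
    have : c⁻¹ 0 = 0 := by rw [Equiv.Perm.inv_eq_iff_eq, h]
    simp [matching_apply, this, h]

/-- Recombine the edges at `u` and `v` of an involution so that `u` and `v` are matched. -/
def recombine (u v : ℤ) (B : Equiv.Perm ℤ) : Equiv.Perm ℤ :=
  Equiv.swap v (B u) * B * Equiv.swap v (B u)

theorem recombine_apply {u v : ℤ} {B : Equiv.Perm ℤ} (hB : IsMatching B) (hu : u ≠ 0) (hv : v ≠ 0)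
    (huv : u ≠ v) (z : ℤ) : recombine u v B z =
      if z = u then v else if z = v then u else if z = B u then B v else
        if z = B v then B u else B z := by
  have h1 := hB.invol
  have h2 : B u ≠ u := fun h => hu (hB.fix u h)
  have h3 : B v ≠ v := fun h => hv (hB.fix v h)
  simp only [recombine, Equiv.Perm.mul_apply, Equiv.swap_apply_def]
  grind

theorem recombine_comm_left {u v : ℤ} {B : Equiv.Perm ℤ} (hB : IsMatching B) (hu : u ≠ 0)
    (hv : v ≠ 0) (huv : u ≠ v) : recombine u v B = recombine v u B := by
  ext z
  rw [recombine_apply hB hu hv huv, recombine_apply hB hv hu huv.symm]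
  grind

theorem IsMatching.recombine {u v : ℤ} {B : Equiv.Perm ℤ} (hB : IsMatching B) (hu : u ≠ 0)
    (hv : v ≠ 0) (huv : u ≠ v) : IsMatching (recombine u v B) := by
  have h1 := hB.invol
  have h2 : B u ≠ u := fun h => hu (hB.fix u h)
  have h3 : B v ≠ v := fun h => hv (hB.fix v h)
  have h4 := hB.fix
  have h5 := hB.zero
  refine ⟨fun x => ?_, fun x => ?_, ?_⟩
  · simp [_root_.recombine, h1]
  · rw [recombine_apply hB hu hv huv]
    grind
  · rw [recombine_apply hB hu hv huv]
    grind

/-- Only the edges at the four labels matter, so this is a finite check on which of them are already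
partners of one another. -/
theorem recombine_recombine {u v x y : ℤ} {B : Equiv.Perm ℤ} (hB : IsMatching B) (hu : u ≠ 0)
    (hv : v ≠ 0) (huv : u ≠ v) (hx : x ≠ 0) (hy : y ≠ 0) (hxy : x ≠ y) (hux : u ≠ x) (huy : u ≠ y)
    (hvx : v ≠ x) (hvy : v ≠ y) :
    recombine x y (recombine u v B) = recombine u v (recombine x y B) := by
  have h1 := hB.invol
  have h2 : ∀ z, z ≠ 0 → B z ≠ z := fun z hz h => hz (hB.fix z h)
  have hBu := h2 u hu
  have hBv := h2 v hv
  have hBx := h2 x hx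
  have hBy := h2 y hy
  clear h2
  have hinj : ∀ a b, B a = b ↔ a = B b := fun a b =>
    ⟨fun h => by rw [← h, h1], fun h => by rw [h, h1]⟩
  ext z
  simp only [recombine_apply (hB.recombine hu hv huv) hx hy hxy,
    recombine_apply (hB.recombine hx hy hxy) hu hv huv, recombine_apply hB hu hv huv,
    recombine_apply hB hx hy hxy]
  by_cases h1 : B u = v
  · have h2 : B v = u := by rw [← h1, hinj]
    grind (splits := 40)
  by_cases h2 : B x = y
  · have h3 : B y = x := by rw [← h2, hinj]
    grind (splits := 40)
  by_cases h3 : B u = x <;> by_cases h4 : B u = y <;> by_cases h5 : B v = x <;>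
    by_cases h6 : B v = y <;> grind (splits := 40)

/-- Matching `u` with `v` creates the edge `{x, y}` as a by-product exactly when `{u, v}` and `{x,
y}` are joined crosswise, a condition symmetric in the two pairs. The two orders of processing
therefore miss equally many edges. -/
theorem recombine_miss {u v x y : ℤ} {B : Equiv.Perm ℤ} (hB : IsMatching B) (hu : u ≠ 0)
    (hv : v ≠ 0) (huv : u ≠ v) (hx : x ≠ 0) (hy : y ≠ 0) (hxy : x ≠ y) (hux : u ≠ x) (huy : u ≠ y)
    (hvx : v ≠ x) (hvy : v ≠ y) :
    (if B u = v then 0 else 1) + (if recombine u v B x = y then 0 else 1) =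
      (if B x = y then 0 else 1) + (if recombine x y B u = v then 0 else 1) := by
  have h1 := hB.invol
  have h2 : ∀ z, z ≠ 0 → B z ≠ z := fun z hz h => hz (hB.fix z h)
  have hBu := h2 u hu
  have hBv := h2 v hv
  have hBx := h2 x hx
  have hBy := h2 y hy
  clear h2
  rw [recombine_apply hB hu hv huv, recombine_apply hB hx hy hxy]
  grind

-- Counting the missing pointer edges.

/-- The number of edges `{i, -(i+1)}`, for `i` in a list, that have to be created if they are
brought into the matching `B` one after the other. -/
def sortDist : List ℤ → Equiv.Perm ℤ → ℕ
  | [], _ => 0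
  | i :: l, B => (if B i = -(i + 1) then 0 else 1) + sortDist l (recombine i (-(i + 1)) B)

theorem sortDist_le (l : List ℤ) (B : Equiv.Perm ℤ) : sortDist l B ≤ l.length := by
  induction l generalizing B with
  | nil => simp [sortDist]
  | cons i l ih =>
    have := ih (recombine i (-(i + 1)) B)
    simp only [sortDist, List.length_cons]
    split_ifs <;> omega

/-- Adjacent transpositions suffice. Positivity and distinctness of the indices make the label pairs
`{i, -(i+1)}` disjoint, which the two commutation lemmas need. -/
theorem sortDist_perm {l l' : List ℤ} (h : l.Perm l') {B : Equiv.Perm ℤ} (hB : IsMatching B)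
    (hn : l.Nodup) (hp : ∀ i ∈ l, 0 < i) : sortDist l B = sortDist l' B := by
  induction h generalizing B with
  | nil => rfl
  | cons i _ ih =>
    have hi := hp i (by simp)
    simp only [sortDist]
    rw [ih (hB.recombine (by omega) (by omega) (by omega)) hn.of_cons
      fun j hj => hp j (List.mem_cons_of_mem _ hj)]
  | swap i j l =>
    have hi := hp i (by simp)
    have hj := hp j (by simp)
    have hij : i ≠ j := by
      rintro rfl
      simp at hn
    simp only [sortDist, ← add_assoc]
    rw [recombine_miss hB, recombine_recombine hB] <;> omega
  | trans h₁ _ ih₁ ih₂ =>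
    rw [ih₁ hB hn hp, ih₂ hB (h₁.nodup_iff.1 hn) fun i hi => hp i (h₁.mem_iff.2 hi)]

/-- Bring `i` to the front on both sides. Its edge is missing before the recombination and present
after it, and all later steps coincide. -/
theorem sortDist_recombine {l : List ℤ} {i : ℤ} (hi : i ∈ l) {B : Equiv.Perm ℤ}
    (hB : IsMatching B) (hn : l.Nodup) (hp : ∀ i ∈ l, 0 < i) (hne : B i ≠ -(i + 1)) :
    sortDist l B = sortDist l (recombine i (-(i + 1)) B) + 1 := by
  have h0 := hp i hi
  have hB' := hB.recombine (u := i) (v := -(i + 1)) (by omega) (by omega) (by omega)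
  have e : recombine i (-(i + 1)) B i = -(i + 1) := by
    rw [recombine_apply hB (by omega) (by omega) (by omega), if_pos rfl]
  have hl := List.perm_cons_erase hi
  rw [sortDist_perm hl hB hn hp, sortDist_perm hl hB' hn hp]
  simp only [sortDist, e, if_neg hne, if_true]
  -- Once the edge is present, the conjugating swap is trivial.
  have : recombine i (-(i + 1)) (recombine i (-(i + 1)) B) = recombine i (-(i + 1)) B := by
    ext z
    conv_lhs => rw [recombine, e]
    simp
  rw [this]
  omega

-- Cyclic words and the effect of a block reversal on their matchings.

open Equiv in
theorem matching_swap_mul (a b : ℤ) (k : Perm ℤ) :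
    matching (swap a b * k) = swap (-a) (-b) * matching k * swap (-a) (-b) := by
  have h : Equiv.neg ℤ * swap a b = swap (-a) (-b) * Equiv.neg ℤ :=
    mul_swap_eq_swap_mul (Equiv.neg ℤ) a b
  have h' : swap a b * Equiv.neg ℤ = Equiv.neg ℤ * swap (-a) (-b) := by
    have := mul_swap_eq_swap_mul (Equiv.neg ℤ) (-a) (-b)
    simpa using this.symm
  calc matching (swap a b * k)
      = (Equiv.neg ℤ * swap a b) * k * Equiv.neg ℤ * k⁻¹ * (swap a b * Equiv.neg ℤ) := by
        simp only [matching, mul_inv_rev, swap_inv, mul_assoc]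
    _ = _ := by
        rw [h, h']
        simp only [matching, mul_assoc]

/-- A transposition merges the cycles of the two parts into one; read the other way, it cuts the
block `Y` out of the cyclic word. -/
theorem formPerm_append {α : Type*} [DecidableEq α] (Y : List α) (hY : Y ≠ []) (w : α)
    (W : List α) (hn : (Y ++ w :: W).Nodup) : (Y ++ w :: W).formPerm =
      Equiv.swap (Y.head hY) w * Y.formPerm * (w :: W).formPerm := by
  induction Y with
  | nil => simp at hY
  | cons y Y ih =>
    match Y with
    | [] => simp
    | y' :: Y =>
      have := ih (by simp) (by simp at hn ⊢; tauto)
      simp only [List.cons_append, List.formPerm_cons_cons, List.head_cons] at this ⊢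
      rw [this, ← mul_assoc, ← mul_assoc, Equiv.mul_swap_eq_swap_mul, mul_assoc (Equiv.swap y w)]
      have h1 : w ≠ y := by rintro rfl; simp at hn
      have h2 : w ≠ y' := by rintro rfl; simp at hn
      rw [Equiv.swap_apply_right, Equiv.swap_apply_of_ne_of_ne h1 h2]
      simp only [mul_assoc]

/-- The list of negated entries in reverse order. -/
def negRev (l : List ℤ) : List ℤ := l.reverse.map fun x => -x

theorem mem_negRev {l : List ℤ} {x : ℤ} : x ∈ negRev l ↔ -x ∈ l := by
  simp only [negRev, List.mem_map, List.mem_reverse]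
  constructor
  · rintro ⟨a, ha, rfl⟩
    simpa
  · exact fun h => ⟨-x, h, by simp⟩

theorem formPerm_map_equiv {α β : Type*} [DecidableEq α] [DecidableEq β] (e : α ↪ β) (l : List α)
    (x : α) : (l.map e).formPerm (e x) = e (l.formPerm x) := by
  induction l with
  | nil => simp
  | cons a l ih =>
    match l with
    | [] => simp
    | b :: l =>
      simp only [List.map_cons, List.formPerm_cons_cons, Equiv.Perm.mul_apply] at ih ⊢
      rw [ih, e.injective.swap_apply]

theorem formPerm_negRev (l : List ℤ) :
    (negRev l).formPerm = Equiv.neg ℤ * l.formPerm⁻¹ * Equiv.neg ℤ := by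
  rw [← List.formPerm_reverse]
  ext x
  have := formPerm_map_equiv (Equiv.neg ℤ).toEmbedding l.reverse (-x)
  simpa [negRev] using this

/-- The entries have distinct absolute values and are not zero. -/
structure Admissible (w : List ℤ) : Prop where
  nodup : w.Nodup
  neg : ∀ x ∈ w, -x ∉ w

theorem Admissible.perm {w w' : List ℤ} (h : Admissible w) (hp : w.Perm w') : Admissible w' :=
  ⟨hp.nodup_iff.1 h.nodup, fun x hx hx' => h.neg x (hp.mem_iff.2 hx) (hp.mem_iff.2 hx')⟩

theorem Admissible.ne_zero {w : List ℤ} (h : Admissible w) {x : ℤ} (hx : x ∈ w) : x ≠ 0 := by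
  rintro rfl
  exact h.neg 0 hx (by simpa)

theorem Admissible.isMatching {w : List ℤ} (h : Admissible w) : IsMatching (matching w.formPerm) :=
  isMatching_matching (List.formPerm_apply_of_notMem fun h0 => h.ne_zero h0 rfl)

theorem formPerm_inv_of_notMem {w : List ℤ} {x : ℤ} (h : x ∉ w) : w.formPerm⁻¹ x = x := by
  rw [Equiv.Perm.inv_eq_iff_eq, List.formPerm_apply_of_notMem h]

theorem Admissible.matching_mem {w : List ℤ} (h : Admissible w) {x : ℤ} (hx : x ∈ w) :
    matching w.formPerm x = -w.formPerm x := by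
  rw [matching_apply, formPerm_inv_of_notMem (h.neg x hx), neg_neg]

theorem Admissible.matching_neg_mem {w : List ℤ} (h : Admissible w) {x : ℤ} (hx : x ∈ w) :
    matching w.formPerm (-x) = w.formPerm⁻¹ x := by
  rw [matching_apply, neg_neg]
  have : w.formPerm⁻¹ x ∈ w := by
    rw [← List.formPerm_mem_iff_mem]
    simpa using hx
  rw [List.formPerm_apply_of_notMem (h.neg _ this), neg_neg]

/-- Flipping a closed cycle `y` replaces it by `N * y⁻¹ * N`, where `N` is negation. Admissibility
makes the supports of `y` and its flip disjoint, so the two commute, and both conjugate `N` to the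
same involution. -/
theorem matching_negRev_mul {Y W : List ℤ} (h : Admissible (Y ++ W)) :
    matching ((negRev Y).formPerm * W.formPerm) = matching (Y.formPerm * W.formPerm) := by
  have hY := h.neg
  have hd := List.disjoint_of_nodup_append h.nodup
  have c1 : Commute (negRev Y).formPerm W.formPerm := by
    refine Equiv.Perm.Disjoint.commute fun x => ?_
    by_cases hx : x ∈ W
    · refine .inl (List.formPerm_apply_of_notMem fun h => ?_)
      rw [mem_negRev] at h
      exact hY x (by simp [hx]) (by simp [h])
    · exact .inr (List.formPerm_apply_of_notMem hx)
  have c2 : Commute Y.formPerm W.formPerm := by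
    refine Equiv.Perm.Disjoint.commute fun x => ?_
    by_cases hx : x ∈ W
    · exact .inl (List.formPerm_apply_of_notMem fun h => hd h hx)
    · exact .inr (List.formPerm_apply_of_notMem hx)
  have c3 : Commute Y.formPerm (negRev Y).formPerm := by
    refine Equiv.Perm.Disjoint.commute fun x => ?_
    by_cases hx : x ∈ Y
    · refine .inr (List.formPerm_apply_of_notMem fun h => ?_)
      rw [mem_negRev] at h
      exact hY x (by simp [hx]) (by simp [h])
    · exact .inl (List.formPerm_apply_of_notMem hx)
  have hN : Equiv.neg ℤ * Equiv.neg ℤ = 1 := by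
    ext
    simp
  rw [c1.eq, c2.eq]
  have key : (negRev Y).formPerm * Equiv.neg ℤ * (negRev Y).formPerm⁻¹ =
      Y.formPerm * Equiv.neg ℤ * Y.formPerm⁻¹ := by
    have e : (negRev Y).formPerm⁻¹ = Equiv.neg ℤ * Y.formPerm * Equiv.neg ℤ := by
      rw [formPerm_negRev]
      ext
      simp
    have e' : Equiv.neg ℤ * Y.formPerm⁻¹ = (negRev Y).formPerm * Equiv.neg ℤ := by
      rw [formPerm_negRev, mul_assoc, hN, mul_one]
    calc _ = (negRev Y).formPerm * (Equiv.neg ℤ * Equiv.neg ℤ) * Y.formPerm * Equiv.neg ℤ := by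
          rw [e]
          simp only [mul_assoc]
      _ = Y.formPerm * (Equiv.neg ℤ * Y.formPerm⁻¹) := by
          rw [e', hN, mul_one, ← c3.eq, mul_assoc]
      _ = _ := by rw [mul_assoc]
  simp only [matching, mul_inv_rev]
  calc _ = Equiv.neg ℤ * W.formPerm * ((negRev Y).formPerm * Equiv.neg ℤ * (negRev Y).formPerm⁻¹)
        * W.formPerm⁻¹ * Equiv.neg ℤ := by simp only [mul_assoc]
    _ = _ := by
      rw [key]
      simp only [mul_assoc]

theorem matching_negRev {w : List ℤ} (h : Admissible w) :
    matching (negRev w).formPerm = matching w.formPerm := by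
  simpa using matching_negRev_mul (Y := w) (W := []) (by simpa using h)

theorem nodup_negRev_append {Y W : List ℤ} (h : Admissible (Y ++ W)) : (negRev Y ++ W).Nodup := by
  refine List.Nodup.append ?_ h.nodup.of_append_right fun x hx hx' => ?_
  · exact (List.nodup_reverse.2 h.nodup.of_append_left).map neg_injective
  · exact h.neg x (by simp [hx']) (by simp [mem_negRev.1 hx])

/-- Cut `Y` out as a separate cycle, flip it, which does not change the matching, and glue it back
in. Cutting and gluing are conjugations by swaps, and their combined effect is to exchange the
labels of the two outer sides of the block. -/
theorem matching_reversal {Y W : List ℤ} (hY : Y ≠ []) (hW : W ≠ []) (h : Admissible (Y ++ W)) :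
    matching (negRev Y ++ W).formPerm =
      Equiv.swap (Y.getLast hY) (-Y.head hY) * matching (Y ++ W).formPerm *
        Equiv.swap (Y.getLast hY) (-Y.head hY) := by
  obtain ⟨w, W, rfl⟩ := List.exists_cons_of_ne_nil hW
  have hne : negRev Y ≠ [] := by simpa [negRev] using hY
  have hh : (negRev Y).head hne = -Y.getLast hY := by simp [negRev]
  rw [formPerm_append _ hne _ _ (nodup_negRev_append h), formPerm_append _ hY _ _ h.nodup,
    mul_assoc (Equiv.swap _ w), mul_assoc (Equiv.swap _ w), matching_swap_mul, matching_swap_mul,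
    matching_negRev_mul h, hh, neg_neg]
  set B := matching (Y.formPerm * (w :: W).formPerm) with hB
  set a := Y.head hY with ha
  set z := Y.getLast hY with hz
  have hzY : z ∈ Y := List.getLast_mem hY
  have haY : a ∈ Y := List.head_mem hY
  have haw : w ≠ a := fun e => List.disjoint_of_nodup_append h.nodup haY (by simp [e])
  -- In the closed-up block the last entry is followed by the first, so its two outer sides are
  -- partners, and `B` commutes with the swap that exchanges them.
  have hBz : B z = -a := by
    have hn : -z ∉ Y ++ w :: W := h.neg z (by simp [hzY])
    rw [List.mem_append, not_or] at hn
    have hd : z ∉ w :: W := fun hz => List.disjoint_of_nodup_append h.nodup hzY hz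
    have : Y.formPerm z = a := by
      obtain ⟨y, Y, rfl⟩ := List.exists_cons_of_ne_nil hY
      simp [hz, ha]
    rw [hB, matching_apply, mul_inv_rev, Equiv.Perm.mul_apply, Equiv.Perm.mul_apply,
      formPerm_inv_of_notMem hn.1, formPerm_inv_of_notMem hn.2, neg_neg,
      List.formPerm_apply_of_notMem hd, this]
  have hBa : B (-a) = z := by rw [← hBz, hB, matching_matching]
  have hc : B * Equiv.swap z (-a) = Equiv.swap z (-a) * B := by
    rw [Equiv.mul_swap_eq_swap_mul, hBz, hBa, Equiv.swap_comm]
  have hzw : z ≠ -w := fun e => h.neg w (by simp) (by simp [← e, hzY])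
  have hs : Equiv.swap z (-a) * Equiv.swap (-a) (-w) = Equiv.swap z (-w) * Equiv.swap z (-a) := by
    rw [Equiv.mul_swap_eq_swap_mul, Equiv.swap_apply_right,
      Equiv.swap_apply_of_ne_of_ne hzw.symm (by simpa using haw)]
  have hs' : Equiv.swap (-a) (-w) * Equiv.swap z (-a) = Equiv.swap z (-a) * Equiv.swap z (-w) := by
    have := congrArg (·⁻¹) hs
    simpa [mul_inv_rev] using this
  calc _ = Equiv.swap z (-w) * B * Equiv.swap z (-w) := rfl
    _ = Equiv.swap z (-w) * (Equiv.swap z (-a) * B * Equiv.swap z (-a)) * Equiv.swap z (-w) := by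
      rw [← hc, mul_assoc B, Equiv.swap_mul_self, mul_one]
    _ = (Equiv.swap z (-w) * Equiv.swap z (-a)) * B * (Equiv.swap z (-a) * Equiv.swap z (-w)) := by
      simp only [mul_assoc]
    _ = _ := by
      rw [← hs, ← hs']
      simp only [mul_assoc]

theorem formPerm_append_comm {X Y : List ℤ} (h : (X ++ Y).Nodup) :
    (X ++ Y).formPerm = (Y ++ X).formPerm :=
  List.formPerm_eq_of_isRotated h List.isRotated_append

theorem formPerm_getLast {w : List ℤ} (hw : w ≠ []) : w.formPerm (w.getLast hw) = w.head hw := by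
  obtain ⟨y, Y, rfl⟩ := List.exists_cons_of_ne_nil hw
  simp

/-- Reversing a block that ends at `b` and is preceded by `a`. -/
theorem matching_reversal_right {X Y Z : List ℤ} {a b : ℤ}
    (h : Admissible (X ++ a :: (Y ++ b :: Z))) :
    matching (X ++ a :: (negRev (Y ++ [b]) ++ Z)).formPerm =
      recombine a b (matching (X ++ a :: (Y ++ b :: Z)).formPerm) := by
  have e1 : X ++ a :: (negRev (Y ++ [b]) ++ Z) = (X ++ [a]) ++ (negRev (Y ++ [b]) ++ Z) := by simp
  have e2 : X ++ a :: (Y ++ b :: Z) = (X ++ [a]) ++ (Y ++ [b] ++ Z) := by simp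
  rw [e2] at h ⊢
  rw [e1]
  have h' : Admissible ((Y ++ [b]) ++ (Z ++ (X ++ [a]))) := by
    refine h.perm ?_
    rw [← List.append_assoc (Y ++ [b])]
    exact List.perm_append_comm
  rw [formPerm_append_comm h.nodup, List.append_assoc (Y ++ [b])]
  have hn := nodup_negRev_append h'
  rw [← List.append_assoc] at hn
  rw [← formPerm_append_comm hn, List.append_assoc (negRev _),
    matching_reversal (by simp) (by simp) h']
  -- After rotation `a` is the last entry, so its successor is the head of the block. The swap in
  -- `matching_reversal` is thus the one in `recombine a b`.
  have hB : matching ((Y ++ [b]) ++ (Z ++ (X ++ [a]))).formPerm a =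
      -(Y ++ [b]).head (by simp) := by
    rw [h'.matching_mem (by simp)]
    have := formPerm_getLast (w := (Y ++ [b]) ++ (Z ++ (X ++ [a]))) (by simp)
    simp only [List.getLast_append_of_ne_nil, ne_eq, List.append_eq_nil_iff, List.cons_ne_nil,
      and_false, not_false_eq_true, List.getLast_singleton] at this
    rw [this, List.head_append_of_ne_nil]
  rw [recombine, hB]
  simp

/-- Reversing a block that starts at `a` and is followed by `b`. -/
theorem matching_reversal_left {X Y Z : List ℤ} {a b : ℤ}
    (h : Admissible (X ++ a :: (Y ++ b :: Z))) :
    matching (X ++ (negRev (a :: Y) ++ b :: Z)).formPerm =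
      recombine (-a) (-b) (matching (X ++ a :: (Y ++ b :: Z)).formPerm) := by
  have ha : a ≠ 0 := h.ne_zero (by simp)
  have hb : b ≠ 0 := h.ne_zero (by simp)
  have hab : a ≠ b := by
    rintro rfl
    have := h.nodup
    simp [List.nodup_append] at this
  rw [recombine_comm_left h.isMatching (by simpa) (by simpa) (by simpa)]
  have e2 : X ++ a :: (Y ++ b :: Z) = X ++ (a :: Y ++ (b :: Z)) := by simp
  rw [e2] at h ⊢
  have h' : Admissible ((a :: Y) ++ ((b :: Z) ++ X)) := by
    refine h.perm ?_
    rw [← List.append_assoc (a :: Y)]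
    exact List.perm_append_comm
  rw [formPerm_append_comm h.nodup, List.append_assoc (a :: Y)]
  have hn := nodup_negRev_append h'
  rw [← List.append_assoc] at hn
  rw [← formPerm_append_comm hn, List.append_assoc (negRev _),
    matching_reversal (by simp) (by simp) h']
  -- The left side of `b` is joined to the right side of the last entry of the block.
  have hB : matching ((a :: Y) ++ ((b :: Z) ++ X)).formPerm (-b) =
      (a :: Y).getLast (by simp) := by
    rw [h'.matching_neg_mem (by simp), Equiv.Perm.inv_eq_iff_eq, formPerm_append_comm h'.nodup]
    have := formPerm_getLast (w := ((b :: Z) ++ X) ++ (a :: Y)) (by simp)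
    rw [List.getLast_append_of_ne_nil _ (by simp)] at this
    rw [this]
    simp
  rw [recombine, hB, List.head_cons, Equiv.swap_comm]

-- Recombinations of positive words as transpositions, and signs.

/-- Recombining the matching of a successor permutation that fixes the negative labels. -/
theorem recombine_matching {c : Equiv.Perm ℤ} (hc : ∀ x ≤ 0, c x = x) {i : ℤ} (hi : 0 < i) :
    recombine i (-(i + 1)) (matching c) = matching (Equiv.swap (c i) (i + 1) * c) := by
  have e : matching c i = -c i := by
    rw [matching_apply, (Equiv.Perm.inv_eq_iff_eq.2 (hc (-i) (by omega)).symm), neg_neg]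
  rw [matching_swap_mul, recombine, e, Equiv.swap_comm]

theorem sign_formPerm {α : Type*} [DecidableEq α] [Fintype α] {l : List α} (hl : l.Nodup) :
    Equiv.Perm.sign l.formPerm = (-1) ^ (l.length - 1) := by
  induction l with
  | nil => simp
  | cons a l ih =>
    match l with
    | [] => simp
    | b :: l =>
      have hab : a ≠ b := by rintro rfl; simp at hl
      rw [List.formPerm_cons_cons, Equiv.Perm.sign_mul, Equiv.Perm.sign_swap hab, ih hl.of_cons]
      simp [pow_succ]

theorem ofSubtype_formPerm {α : Type*} [DecidableEq α] {p : α → Prop} [DecidablePred p]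
    (l : List (Subtype p)) :
    Equiv.Perm.ofSubtype l.formPerm = (l.map Subtype.val).formPerm := by
  induction l with
  | nil => simp
  | cons a l ih =>
    match l with
    | [] => simp
    | b :: l =>
      simp only [List.formPerm_cons_cons, List.map_cons, map_mul, Equiv.Perm.ofSubtype_swap_eq] at ih ⊢
      rw [ih]

/-- Each step multiplies the successor permutation by the transposition of `c i` and `i + 1`, which
is the identity exactly when the edge is already there; the sign thus counts the missing edges. The
middle clause ensures that no step undoes an earlier one. -/
theorem exists_sort {p : ℤ → Prop} [DecidablePred p] [Fintype (Subtype p)]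
    (hpos : ∀ x, p x → 0 < x) (l : List ℤ) (hl : ∀ i ∈ l, p i ∧ p (i + 1))
    (c : Equiv.Perm (Subtype p)) : ∃ c' : Equiv.Perm (Subtype p),
      Equiv.Perm.sign c' =
        (-1) ^ sortDist l (matching (Equiv.Perm.ofSubtype c)) * Equiv.Perm.sign c ∧
      (∀ x : Subtype p, (c x : ℤ) = x + 1 → (c' x : ℤ) = x + 1) ∧
      ∀ x : Subtype p, (x : ℤ) ∈ l → (c' x : ℤ) = x + 1 := by
  induction l generalizing c with
  | nil => exact ⟨c, by simp [sortDist]⟩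
  | cons i l ih =>
    obtain ⟨hi, hi'⟩ := hl i (by simp)
    have h0 := hpos i hi
    set x₀ : Subtype p := ⟨i, hi⟩
    set x₁ : Subtype p := ⟨i + 1, hi'⟩
    have hfix : ∀ x ≤ 0, Equiv.Perm.ofSubtype c x = x := fun x hx =>
      Equiv.Perm.ofSubtype_apply_of_not_mem _ fun hp => by have := hpos x hp; omega
    have e : recombine i (-(i + 1)) (matching (Equiv.Perm.ofSubtype c)) =
        matching (Equiv.Perm.ofSubtype (Equiv.swap (c x₀) x₁ * c)) := by
      rw [recombine_matching hfix h0, map_mul, Equiv.Perm.ofSubtype_swap_eq]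
      have : Equiv.Perm.ofSubtype c i = c x₀ := Equiv.Perm.ofSubtype_apply_coe c x₀
      rw [this]
    have em : matching (Equiv.Perm.ofSubtype c) i = -(c x₀ : ℤ) := by
      have : Equiv.Perm.ofSubtype c i = c x₀ := Equiv.Perm.ofSubtype_apply_coe c x₀
      rw [matching_apply, (Equiv.Perm.inv_eq_iff_eq.2 (hfix (-i) (by omega)).symm), neg_neg, this]
    obtain ⟨c', h1, h2, h3⟩ := ih (fun j hj => hl j (by simp [hj])) (Equiv.swap (c x₀) x₁ * c)
    -- For `x ≠ x₀`, the value `c x` differs from `c x₀` by injectivity and from `x₁` because `x + 1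
    -- ≠ i + 1`.
    have hkeep : ∀ x : Subtype p, (c x : ℤ) = x + 1 →
        ((Equiv.swap (c x₀) x₁ * c) x : ℤ) = x + 1 := by
      intro x hx
      rw [Equiv.Perm.mul_apply]
      by_cases hxi : x = x₀
      · rw [hxi, Equiv.swap_apply_left]
      · rw [Equiv.swap_apply_of_ne_of_ne (by simpa using hxi), hx]
        intro h
        rw [h] at hx
        apply hxi
        ext
        simp only [x₁, x₀] at hx ⊢
        omega
    have hnew : ((Equiv.swap (c x₀) x₁ * c) x₀ : ℤ) = x₀ + 1 := by
      rw [Equiv.Perm.mul_apply, Equiv.swap_apply_left]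
    refine ⟨c', ?_, fun x hx => h2 x (hkeep x hx), fun x hx => ?_⟩
    · rw [h1, ← e, sortDist, Equiv.Perm.sign_mul, em, pow_add]
      by_cases hm : c x₀ = x₁
      · have hm' : (c x₀ : ℤ) = i + 1 := by rw [hm]
        rw [hm', if_pos rfl, hm, Equiv.swap_self]
        simp
      · have hm' : ¬ (-(c x₀ : ℤ)) = -(i + 1) := fun h => hm (Subtype.ext (neg_injective h))
        rw [if_neg hm', Equiv.Perm.sign_swap hm]
        simp
    · rcases List.mem_cons.1 hx with h | h
      · have : x = x₀ := Subtype.ext h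
        rw [this]
        exact h2 x₀ hnew
      · exact h3 x h

/-- The first coordinates of the pointers. -/
def pointerList (n : ℕ) : List ℤ := (List.range' 1 (n - 1)).map Nat.cast

theorem mem_pointerList {n : ℕ} {i : ℤ} : i ∈ pointerList n ↔ 1 ≤ i ∧ i + 1 ≤ n := by
  simp only [pointerList, List.mem_map, List.mem_range'_1]
  constructor
  · rintro ⟨a, ha, rfl⟩
    omega
  · exact fun h => ⟨i.toNat, by omega, by omega⟩

theorem nodup_pointerList (n : ℕ) : (pointerList n).Nodup :=
  (List.nodup_range' (step := 1)).map Nat.cast_injective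

theorem perm_ext_of_ne {α : Type*} {f g : Equiv.Perm α} (a : α) (h : ∀ x, x ≠ a → f x = g x) :
    f = g := by
  have h' : ∀ x, x ≠ a → (g⁻¹ * f) x = x := fun x hx => by simp [h x hx]
  have ha : (g⁻¹ * f) a = a := by
    by_contra hne
    exact hne ((g⁻¹ * f).injective (h' _ hne))
  have : g⁻¹ * f = 1 := by
    ext x
    by_cases hx : x = a
    · rw [hx, ha]; rfl
    · rw [h' x hx]; rfl
  exact (inv_mul_eq_one.1 this).symm

/-- For `n > 0` the process leads from the `n`-cycle of `w` to the cycle `1, …, n`. Both have sign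
`(-1) ^ (n - 1)`, so the number of nontrivial transpositions is even. -/
theorem even_sortDist_of_pos {n : ℕ} {w : List ℤ} (hw : w.Nodup)
    (hmem : ∀ x, x ∈ w ↔ 1 ≤ x ∧ x ≤ n) (hlen : w.length = n) :
    Even (sortDist (pointerList n) (matching w.formPerm)) := by
  rcases Nat.eq_zero_or_pos n with rfl | hn
  · simp [pointerList, sortDist]
  let p : ℤ → Prop := fun x => x ∈ Finset.Icc 1 (n : ℤ)
  have : Fintype (Subtype p) := inferInstanceAs (Fintype {x // x ∈ Finset.Icc 1 (n : ℤ)})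
  have hp : ∀ x, p x ↔ 1 ≤ x ∧ x ≤ n := fun x => Finset.mem_Icc
  have lift : ∀ w : List ℤ, w.Nodup → (∀ x ∈ w, p x) → w.length = n →
      ∃ c : Equiv.Perm (Subtype p), Equiv.Perm.ofSubtype c = w.formPerm ∧
        Equiv.Perm.sign c = (-1) ^ (n - 1) := by
    intro w hw hmem hlen
    refine ⟨(w.attach.map fun x => ⟨x.1, hmem x.1 x.2⟩ : List (Subtype p)).formPerm, ?_, ?_⟩
    · rw [ofSubtype_formPerm, List.map_map]
      congr 1
      exact List.attach_map_subtype_val w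
    · rw [sign_formPerm]
      · simp [hlen]
      · refine (List.nodup_attach.2 hw).map fun x y h => Subtype.ext ?_
        simpa using h
  obtain ⟨c, hc, hs⟩ := lift w hw (fun x hx => (hp x).2 ((hmem x).1 hx)) hlen
  set r : List ℤ := (List.range' 1 n).map Nat.cast with hr
  obtain ⟨c₀, hc₀, hs₀⟩ := lift r ((List.nodup_range' (step := 1)).map Nat.cast_injective)
    (fun x hx => by
      simp only [hr, List.mem_map, List.mem_range'_1] at hx
      obtain ⟨a, ha, rfl⟩ := hx
      exact (hp _).2 (by omega)) (by simp [hr])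
  obtain ⟨c', h1, -, h3⟩ := exists_sort (p := p) (fun x hx => by have := (hp x).1 hx; omega)
    (pointerList n) (fun i hi => by
      rw [mem_pointerList] at hi
      exact ⟨(hp _).2 (by omega), (hp _).2 (by omega)⟩) c
  -- All pointers are in place in `c'`, so it agrees with the standard cycle away from `n`, and
  -- hence also at `n`.
  have heq : c' = c₀ := by
    refine perm_ext_of_ne ⟨n, (hp _).2 (by omega)⟩ fun x hx => Subtype.ext ?_
    have hxp := (hp x).1 x.2
    have hxn : (x : ℤ) ≠ n := fun h => hx (Subtype.ext h)
    rw [h3 x (mem_pointerList.2 (by omega)), ← Equiv.Perm.ofSubtype_apply_coe, hc₀]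
    have := List.formPerm_apply_lt_getElem r ((List.nodup_range' (step := 1)).map Nat.cast_injective)
      (x.1.toNat - 1) (by simp [hr]; omega)
    simp only [hr, List.getElem_map, List.getElem_range', one_mul] at this
    rw [← hr] at this
    have e1 : ((1 + (x.1.toNat - 1) : ℕ) : ℤ) = x := by omega
    have e2 : ((1 + (x.1.toNat - 1 + 1) : ℕ) : ℤ) = x + 1 := by omega
    rw [e1, e2] at this
    exact this.symm
  rw [heq, hs₀, hs, hc] at h1
  have h4 : (-1 : ℤˣ) ^ sortDist (pointerList n) (matching w.formPerm) = 1 :=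
    mul_eq_right.1 h1.symm
  by_contra hodd
  rw [Nat.not_even_iff_odd] at hodd
  rw [hodd.neg_one_pow] at h4
  exact absurd h4 (by decide)

-- Reversals between two places of a word.

theorem reverseBetween_append (A B C : List ℤ) :
    reverseBetween A.length (A.length + B.length) (A ++ (B ++ C)) = A ++ (negRev B ++ C) := by
  simp [reverseBetween, negRev]

theorem exists_eq_append_of_idxOf_lt {w : List ℤ} {a b : ℤ} (hb : b ∈ w)
    (h : w.idxOf a < w.idxOf b) : ∃ X Y Z, w = X ++ a :: (Y ++ b :: Z) ∧
      X.length = w.idxOf a ∧ X.length + 1 + Y.length = w.idxOf b := by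
  have hbl := List.idxOf_lt_length_iff.2 hb
  have ha : a ∈ w := List.idxOf_lt_length_iff.1 (h.trans hbl)
  refine ⟨w.take (w.idxOf a), (w.drop (w.idxOf a + 1)).take (w.idxOf b - w.idxOf a - 1),
    w.drop (w.idxOf b + 1), ?_, ?_, ?_⟩
  · have e1 : w = w.take (w.idxOf a) ++ w.drop (w.idxOf a) := (List.take_append_drop _ _).symm
    have e2 : w.drop (w.idxOf a) = a :: w.drop (w.idxOf a + 1) := by
      rw [List.drop_eq_getElem_cons (h.trans hbl), List.getElem_idxOf]
    have e3 : w.drop (w.idxOf a + 1) =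
        (w.drop (w.idxOf a + 1)).take (w.idxOf b - w.idxOf a - 1) ++ w.drop (w.idxOf b) := by
      conv_lhs => rw [← List.take_append_drop (w.idxOf b - w.idxOf a - 1) (w.drop (w.idxOf a + 1))]
      rw [List.drop_drop]
      congr 2
      omega
    have e4 : w.drop (w.idxOf b) = b :: w.drop (w.idxOf b + 1) := by
      rw [List.drop_eq_getElem_cons hbl, List.getElem_idxOf]
    rw [← e4, ← e3, ← e2, ← e1]
  · rw [List.length_take]
    omega
  · rw [List.length_take, List.length_take, List.length_drop]
    omega

/-- This is the case in which both occurrences of the pointer lie to the right of their entries; the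
reversed block contains the later of the two entries and not the earlier. -/
theorem matching_reverseBetween_right {w : List ℤ} (h : Admissible w) {a b : ℤ} (ha : a ∈ w)
    (hb : b ∈ w) (hab : a ≠ b) :
    matching (reverseBetween (min (w.idxOf a + 1) (w.idxOf b + 1))
      (max (w.idxOf a + 1) (w.idxOf b + 1)) w).formPerm = recombine a b (matching w.formPerm) := by
  wlog hlt : w.idxOf a < w.idxOf b generalizing a b
  · have hne : w.idxOf a ≠ w.idxOf b := fun e => hab (List.idxOf_inj ha |>.1 e)
    rw [min_comm, max_comm, this hb ha hab.symm (by omega), recombine_comm_left h.isMatching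
      (h.ne_zero hb) (h.ne_zero ha) hab.symm]
  obtain ⟨X, Y, Z, hw, h1, h2⟩ := exists_eq_append_of_idxOf_lt hb hlt
  rw [min_eq_left (by omega), max_eq_right (by omega), ← h1, ← h2]
  rw [hw] at h ⊢
  rw [← matching_reversal_right h]
  have := reverseBetween_append (X ++ [a]) (Y ++ [b]) Z
  simp only [List.append_assoc, List.length_append, List.length_singleton, List.cons_append,
    List.nil_append] at this
  rw [← this, add_assoc (X.length + 1)]

/-- Here both occurrences lie to the left of their entries, and the block contains the earlier entry
and not the later. -/
theorem matching_reverseBetween_left {w : List ℤ} (h : Admissible w) {a b : ℤ} (ha : a ∈ w)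
    (hb : b ∈ w) (hab : a ≠ b) :
    matching (reverseBetween (min (w.idxOf a) (w.idxOf b)) (max (w.idxOf a) (w.idxOf b)) w).formPerm =
      recombine (-a) (-b) (matching w.formPerm) := by
  wlog hlt : w.idxOf a < w.idxOf b generalizing a b
  · have hne : w.idxOf a ≠ w.idxOf b := fun e => hab (List.idxOf_inj ha |>.1 e)
    have ha0 := h.ne_zero ha
    have hb0 := h.ne_zero hb
    rw [min_comm, max_comm, this hb ha hab.symm (by omega), recombine_comm_left h.isMatching
      (by omega) (by omega) (by omega)]
  obtain ⟨X, Y, Z, hw, h1, h2⟩ := exists_eq_append_of_idxOf_lt hb hlt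
  rw [min_eq_left (by omega), max_eq_right (by omega), ← h1, ← h2]
  rw [hw] at h ⊢
  rw [← matching_reversal_left h]
  have := reverseBetween_append X (a :: Y) (b :: Z)
  simp only [List.cons_append, List.length_cons] at this
  rw [← this, add_right_comm, add_assoc X.length]

-- Signed permutations: the distance, maximal sequences and the two games.

namespace SignedPerm

variable {n : ℕ}

theorem length_word (α : SignedPerm n) : α.word.length = n := by
  simpa using α.perm.length_eq

theorem bounds (α : SignedPerm n) {x : ℤ} (hx : x ∈ α.word) : 1 ≤ x.natAbs ∧ x.natAbs ≤ n := by
  have := α.perm.mem_iff.1 (List.mem_map_of_mem (f := Int.natAbs) hx)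
  rw [List.mem_range'_1] at this
  omega

theorem mem_or_mem (α : SignedPerm n) {i : ℤ} (h1 : 1 ≤ i) (h2 : i ≤ n) :
    i ∈ α.word ∨ -i ∈ α.word := by
  have : i.natAbs ∈ α.word.map Int.natAbs := α.perm.mem_iff.2 (List.mem_range'_1.2 (by omega))
  obtain ⟨a, ha, he⟩ := List.mem_map.1 this
  rcases Int.natAbs_eq_natAbs_iff.1 he with rfl | rfl
  · exact .inl ha
  · exact .inr (by simpa using ha)

theorem admissible (α : SignedPerm n) : Admissible α.word := by
  have hn : (α.word.map Int.natAbs).Nodup := α.perm.nodup_iff.2 (List.nodup_range' (step := 1))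
  refine ⟨hn.of_map _, fun x hx hx' => ?_⟩
  have := List.inj_on_of_nodup_map hn hx hx' (by simp)
  have := α.bounds hx
  omega

/-- The number of recombinations that turn the matching of `α` into one containing all the pointers.
Every cdr move lowers it by `1`. -/
def dist (α : SignedPerm n) : ℕ := sortDist (pointerList n) (matching α.word.formPerm)

theorem dist_le (α : SignedPerm n) : α.dist ≤ n - 1 :=
  (sortDist_le _ _).trans (by simp [pointerList])

theorem oriented_iff (α : SignedPerm n) (p : Pointer n) : α.Oriented p ↔
    ((p.1 : ℤ) ∈ α.word ∧ -((p.1 : ℤ) + 1) ∈ α.word) ∨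
      (-(p.1 : ℤ) ∈ α.word ∧ (p.1 : ℤ) + 1 ∈ α.word) := by
  have hp := p.2.1
  constructor
  · rintro ⟨x, hx, y, hy, hxp, hyp, hxy⟩
    rcases mul_neg_iff.1 hxy with ⟨h1, h2⟩ | ⟨h1, h2⟩
    · left
      rw [show (p.1 : ℤ) = x by omega, show -(x + 1) = y by omega]
      exact ⟨hx, hy⟩
    · right
      rw [show -(p.1 : ℤ) = x by omega, show (p.1 : ℤ) + 1 = y by omega]
      exact ⟨hx, hy⟩
  · rintro (⟨h1, h2⟩ | ⟨h1, h2⟩)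
    · exact ⟨_, h1, _, h2, by omega, by omega, by nlinarith⟩
    · exact ⟨_, h1, _, h2, by omega, by omega, by nlinarith⟩

/-- The sign pattern `i`, `-(i+1)` puts both occurrences to the right of their entries, and `-i`,
`i+1` puts both to the left. The edge is absent beforehand because it would make two entries of
opposite sign into `i, i+1` or `-(i+1), -i`. -/
theorem matching_cdr (α : SignedPerm n) {p : Pointer n} (h : α.Oriented p) :
    matching (α.cdr p).word.formPerm = recombine p.1 (-((p.1 : ℤ) + 1)) (matching α.word.formPerm) ∧
      matching α.word.formPerm p.1 ≠ -((p.1 : ℤ) + 1) := by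
  have hp := p.2.1
  have ha := α.admissible
  rw [cdr, if_pos h]
  dsimp only
  rcases (oriented_iff α p).1 h with ⟨h1, h2⟩ | ⟨h1, h2⟩
  · have h3 : (p.1 : ℤ) + 1 ∉ α.word := fun h => ha.neg _ h h2
    rw [headGap, tailGap, if_pos h1, if_neg h3]
    refine ⟨matching_reverseBetween_right ha h1 h2 (by omega), fun e => h3 ?_⟩
    rw [ha.matching_mem h1, neg_inj] at e
    rw [← e]
    exact List.formPerm_apply_mem_of_mem h1
  · have h3 : (p.1 : ℤ) ∉ α.word := fun h => ha.neg _ h h1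
    rw [headGap, tailGap, if_neg h3, if_pos h2]
    have := matching_reverseBetween_left ha h1 h2 (by omega)
    rw [neg_neg] at this
    refine ⟨this, fun e => ha.neg _ h2 ?_⟩
    have e' := ha.matching_neg_mem h1
    rw [neg_neg, e, eq_comm, Equiv.Perm.inv_eq_iff_eq] at e'
    rw [← List.formPerm_mem_iff_mem, ← e']
    exact h1

theorem dist_cdr (α : SignedPerm n) {p : Pointer n} (h : α.Oriented p) :
    α.dist = (α.cdr p).dist + 1 := by
  obtain ⟨h1, h2⟩ := α.matching_cdr h
  rw [dist, dist, h1]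
  exact sortDist_recombine (mem_pointerList.2 (by have := p.2; omega)) α.admissible.isMatching
    (nodup_pointerList n) (fun i hi => by have := mem_pointerList.1 hi; omega) h2

/-- An applicable cdr never acts trivially, since it lowers `dist`. -/
theorem isCdrFixedPoint_iff (α : SignedPerm n) :
    α.IsCdrFixedPoint ↔ ∀ p : Pointer n, ¬ α.Oriented p := by
  refine forall_congr' fun p => ⟨fun h hp => ?_, fun h => if_neg h⟩
  have := α.dist_cdr hp
  rw [h] at this
  omega

theorem even_dist (α : SignedPerm n) (h : ∀ p : Pointer n, ¬ α.Oriented p) : Even α.dist := by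
  -- Without oriented pointers, the sign of the entry `±1` propagates to all the others.
  have key : ∀ i : ℕ, 1 ≤ i → i ≤ n → (((i : ℤ) ∈ α.word ↔ (1 : ℤ) ∈ α.word) ∧
      (-(i : ℤ) ∈ α.word ↔ (-1 : ℤ) ∈ α.word)) := by
    intro i hi
    induction i, hi using Nat.le_induction with
    | base => simp
    | succ i hi ih =>
      intro hn
      have ih := ih (by omega)
      have hp := h ⟨i, hi, hn⟩
      have h1 := α.mem_or_mem (i := i) (by omega) (by omega)
      have h2 := α.mem_or_mem (i := i + 1) (by omega) (by omega)
      have h3 := α.admissible.neg i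
      have h4 := α.admissible.neg (i + 1)
      rw [oriented_iff, not_or, not_and, not_and] at hp
      push_cast
      rw [← ih.1, ← ih.2]
      clear ih h
      grind
  rcases Nat.eq_zero_or_pos n with rfl | hn
  · simp [dist, pointerList, sortDist]
  have hneg1 := α.admissible.neg 1
  rcases α.mem_or_mem (i := 1) (by omega) (by omega) with h1 | h1
  · refine even_sortDist_of_pos α.admissible.nodup (fun x => ⟨fun hx => ?_, fun hx => ?_⟩)
      α.length_word
    · have hb := α.bounds hx
      by_contra hx'
      have := (key x.natAbs (by omega) (by omega)).2
      rw [show -(x.natAbs : ℤ) = x by omega] at this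
      exact hneg1 h1 (this.1 hx)
    · have := (key x.natAbs (by omega) (by omega)).1
      rw [show (x.natAbs : ℤ) = x by omega] at this
      exact this.2 h1
  -- All entries are negative: read the word backwards with changed signs.
  · rw [dist, ← matching_negRev α.admissible]
    refine even_sortDist_of_pos (by simpa using nodup_negRev_append (W := []) (by simpa using
      α.admissible)) (fun x => ?_) (by simp [negRev, α.length_word])
    rw [mem_negRev]
    refine ⟨fun hx => ?_, fun hx => ?_⟩
    · have hb := α.bounds hx
      by_contra hx'
      have := (key x.natAbs (by omega) (by omega)).1
      rw [show (x.natAbs : ℤ) = -x by omega] at this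
      exact hneg1 (this.1 hx) h1
    · have := (key x.natAbs (by omega) (by omega)).2
      rw [show (x.natAbs : ℤ) = x by omega] at this
      exact this.2 h1

/-- The number `m` is the distance left at the fixed point, which need not vanish. The equation
yields both the parity and the bound on the length. -/
theorem dist_eq_of_isMaximalCdrSeq (α : SignedPerm n) (ps : List (Pointer n))
    (h : α.IsMaximalCdrSeq ps) : ∃ m, Even m ∧ α.dist = ps.length + m := by
  induction ps generalizing α with
  | nil => exact ⟨α.dist, α.even_dist (α.isCdrFixedPoint_iff.1 h), by simp⟩
  | cons p ps ih =>
    obtain ⟨m, hm, e⟩ := ih _ h.2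
    refine ⟨m, hm, ?_⟩
    rw [α.dist_cdr h.1, e, List.length_cons]
    omega

theorem even_length_iff (α : SignedPerm n) {ps : List (Pointer n)}
    (h : α.IsMaximalCdrSeq ps) : Even ps.length ↔ Even α.dist := by
  obtain ⟨m, hm, e⟩ := α.dist_eq_of_isMaximalCdrSeq ps h
  rw [e, Nat.even_add]
  tauto

theorem exists_isMaximalCdrSeq (α : SignedPerm n) : ∃ ps, α.IsMaximalCdrSeq ps := by
  induction hd : α.dist generalizing α with
  | zero =>
    refine ⟨[], α.isCdrFixedPoint_iff.2 fun p hp => ?_⟩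
    have := α.dist_cdr hp
    omega
  | succ d ih =>
    by_cases h : ∃ p, α.Oriented p
    · obtain ⟨p, hp⟩ := h
      obtain ⟨ps, hps⟩ := ih (α.cdr p) (by have := α.dist_cdr hp; omega)
      exact ⟨p :: ps, hp, hps⟩
    · exact ⟨[], α.isCdrFixedPoint_iff.2 (not_exists.1 h)⟩

theorem exists_oriented (α : SignedPerm n) (h : Odd α.dist) : ∃ p, α.Oriented p := by
  by_contra hn
  exact Nat.not_even_iff_odd.2 h (α.even_dist (not_exists.1 hn))

/-- Every move flips the parity of `dist`, and by `exists_oriented` the player to move is never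
stuck when it is odd. -/
theorem normal_iff (α : SignedPerm n) :
    (NormalMoverWins α ↔ Odd α.dist) ∧ (NormalOtherWins α ↔ Even α.dist) := by
  induction hd : α.dist using Nat.strong_induction_on generalizing α with
  | _ d ih =>
    subst hd
    have ih' : ∀ p, α.Oriented p → (NormalMoverWins (α.cdr p) ↔ Even α.dist) ∧
        (NormalOtherWins (α.cdr p) ↔ Odd α.dist) := by
      intro p hp
      have e := α.dist_cdr hp
      have := ih _ (by omega) (α.cdr p) rfl
      rw [this.1, this.2, e, Nat.even_add_one, Nat.odd_add_one, Nat.not_odd_iff_even,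
        Nat.not_even_iff_odd]
      exact ⟨Iff.rfl, Iff.rfl⟩
    refine ⟨⟨fun h => ?_, fun h => ?_⟩, ⟨fun h => ?_, fun h => ?_⟩⟩
    · cases h with
      | move _ p hp h => exact (ih' p hp).2.1 h
    · obtain ⟨p, hp⟩ := α.exists_oriented h
      exact .move α p hp ((ih' p hp).2.2 h)
    · cases h with
      | reply _ h =>
        by_contra hn
        obtain ⟨p, hp⟩ := α.exists_oriented (Nat.not_even_iff_odd.1 hn)
        exact hn ((ih' p hp).1.1 (h p hp))
    · exact .reply α fun p hp => (ih' p hp).1.2 h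

theorem misere_iff (α : SignedPerm n) :
    (MisereMoverWins α ↔ Even α.dist) ∧ (MisereOtherWins α ↔ Odd α.dist) := by
  induction hd : α.dist using Nat.strong_induction_on generalizing α with
  | _ d ih =>
    subst hd
    have ih' : ∀ p, α.Oriented p → (MisereMoverWins (α.cdr p) ↔ Odd α.dist) ∧
        (MisereOtherWins (α.cdr p) ↔ Even α.dist) := by
      intro p hp
      have e := α.dist_cdr hp
      have := ih _ (by omega) (α.cdr p) rfl
      rw [this.1, this.2, e, Nat.even_add_one, Nat.odd_add_one, Nat.not_odd_iff_even,
        Nat.not_even_iff_odd]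
      exact ⟨Iff.rfl, Iff.rfl⟩
    refine ⟨⟨fun h => ?_, fun h => ?_⟩, ⟨fun h => ?_, fun h => ?_⟩⟩
    · cases h with
      | stuck _ h => exact α.even_dist h
      | move _ p hp h => exact (ih' p hp).2.1 h
    · by_cases hp : ∃ p, α.Oriented p
      · obtain ⟨p, hp⟩ := hp
        exact .move α p hp ((ih' p hp).2.2 h)
      · exact .stuck α (not_exists.1 hp)
    · cases h with
      | reply _ hm h =>
        obtain ⟨p, hp⟩ := hm
        exact (ih' p hp).1.1 (h p hp)
    · exact .reply α (α.exists_oriented h) fun p hp => (ih' p hp).1.2 h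

end SignedPerm

-- A calculus of running times and postconditions for programs.

namespace RAM

/-- Started in `s`, the program `P` halts after at most `T` steps in a state satisfying `R`. -/
def Runs (W : ℕ) (P : Prog) (s : State) (T : ℕ) (R : State → Prop) : Prop :=
  ∃ t s', Exec W P s t s' ∧ t ≤ T ∧ R s'

variable {W : ℕ} {P Q : Prog} {s : State} {T T' : ℕ} {R : State → Prop}

theorem Runs.mono {R' : State → Prop} (h : Runs W P s T R) (hT : T ≤ T') (hR : ∀ s, R s → R' s) :
    Runs W P s T' R' := by
  obtain ⟨t, s', h1, h2, h3⟩ := h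
  exact ⟨t, s', h1, h2.trans hT, hR _ h3⟩

theorem Runs.seq (h : Runs W P s T fun s' => Runs W Q s' T' R) :
    Runs W (.seq P Q) s (T + T') R := by
  obtain ⟨t, s', h1, h2, t', s'', h3, h4, h5⟩ := h
  exact ⟨_, _, .seq _ _ _ _ _ _ _ h1 h3, add_le_add h2 h4, h5⟩

theorem runs_const {x : ℕ} {c : ℤ} (h : |c| ≤ (W : ℤ)) (hR : R (s.setReg x c)) :
    Runs W (.const x c) s 1 R :=
  ⟨_, _, .const _ _ _ h, le_rfl, hR⟩

theorem runs_add {x y z : ℕ} (h : |s.reg y + s.reg z| ≤ (W : ℤ))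
    (hR : R (s.setReg x (s.reg y + s.reg z))) : Runs W (.add x y z) s 1 R :=
  ⟨_, _, .add _ _ _ _ h, le_rfl, hR⟩

theorem runs_sub {x y z : ℕ} (h : |s.reg y - s.reg z| ≤ (W : ℤ))
    (hR : R (s.setReg x (s.reg y - s.reg z))) : Runs W (.sub x y z) s 1 R :=
  ⟨_, _, .sub _ _ _ _ h, le_rfl, hR⟩

theorem runs_load {x y : ℕ} (h : 0 ≤ s.reg y)
    (hR : R (s.setReg x (s.mem (s.reg y).toNat))) : Runs W (.load x y) s 1 R :=
  ⟨_, _, .load _ _ _ h, le_rfl, hR⟩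

theorem runs_store {x y : ℕ} (h : 0 ≤ s.reg x)
    (hR : R (s.setMem (s.reg x).toNat (s.reg y))) : Runs W (.store x y) s 1 R :=
  ⟨_, _, .store _ _ _ h, le_rfl, hR⟩

theorem Runs.seq_one (h : Runs W P s 1 fun s' => Runs W Q s' T R) :
    Runs W (.seq P Q) s (T + 1) R := by
  rw [add_comm]
  exact h.seq

theorem runs_ifPos {x : ℕ} (hP : 0 < s.reg x → Runs W P s T R)
    (hQ : ¬ 0 < s.reg x → Runs W Q s T R) : Runs W (.ifPos x P Q) s (T + 1) R := by
  by_cases h : 0 < s.reg x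
  · obtain ⟨t, s', h1, h2, h3⟩ := hP h
    exact ⟨_, _, .ifPos_true _ _ _ _ _ _ h h1, by omega, h3⟩
  · obtain ⟨t, s', h1, h2, h3⟩ := hQ h
    exact ⟨_, _, .ifPos_false _ _ _ _ _ _ h h1, by omega, h3⟩

/-- The invariant is indexed by the number of passes left, not by the register, which may be
negative at the end. -/
theorem runs_whilePos {x : ℕ} {I : ℕ → State → Prop} (h0 : ∀ s, I 0 s → ¬ 0 < s.reg x)
    (hs : ∀ m s, I (m + 1) s → 0 < s.reg x ∧ Runs W P s T (I m)) {m : ℕ} (h : I m s) :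
    Runs W (.whilePos x P) s (m * (T + 1) + 1) (I 0) := by
  induction m generalizing s with
  | zero => exact ⟨_, _, .while_false _ _ _ (h0 s h), by omega, h⟩
  | succ m ih =>
    obtain ⟨hp, t, s', h1, h2, h3⟩ := hs m s h
    obtain ⟨t', s'', h4, h5, h6⟩ := ih h3
    refine ⟨_, _, .while_true _ _ _ _ _ _ _ hp h1 h4, ?_, h6⟩
    rw [add_mul]
    omega

theorem setReg_reg (s : State) (x y : ℕ) (v : ℤ) :
    (s.setReg x v).reg y = if y = x then v else s.reg y := by
  simp [State.setReg, Function.update_apply]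

theorem setReg_mem (s : State) (x : ℕ) (v : ℤ) : (s.setReg x v).mem = s.mem := rfl

theorem setMem_reg (s : State) (x : ℕ) (v : ℤ) : (s.setMem x v).reg = s.reg := rfl

theorem setMem_mem (s : State) (x y : ℕ) (v : ℤ) :
    (s.setMem x v).mem y = if y = x then v else s.mem y := by
  simp [State.setMem, Function.update_apply]

-- The program computing the parity of the distance, and its loop invariants.

/-- One step of the construction of the matching of a word: the entries in register `5` and in the
next input cell are consecutive. The matching is tabulated around the cell held in register `2`. -/
def linkBody : Prog :=
  .seq (.add 4 4 1) <| .seq (.load 6 4) <| .seq (.add 7 2 5) <| .seq (.sub 8 9 6) <|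
  .seq (.store 7 8) <| .seq (.sub 7 2 6) <| .seq (.store 7 5) <| .seq (.add 5 6 9) <| .sub 3 3 1

/-- Read the table at both ends of the next pointer. -/
def readBody : Prog :=
  .seq (.add 4 4 1) <| .seq (.add 7 2 4) <| .seq (.load 5 7) <| .seq (.add 6 4 1) <|
  .seq (.sub 8 2 6) <| .seq (.load 10 8) <| .sub 6 9 6

/-- Recombine the tabulated matching. -/
def writeBody : Prog :=
  .seq (.store 7 6) <| .seq (.store 8 4) <| .seq (.add 7 2 5) <| .seq (.store 7 10) <|
  .seq (.add 8 2 10) <| .store 8 5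

/-- Change register `11` from `0` to `1` or from `1` to `0` if registers `5` and `6` differ. -/
def countBody : Prog :=
  .seq (.sub 3 3 1) <| .seq (.sub 6 5 6) <| .ifPos 6 (.sub 11 1 11) <| .seq (.sub 6 9 6) <|
  .ifPos 6 (.sub 11 1 11) (.const 7 0)

/-- Recombine the tabulated matching at the next pointer, and count modulo `2` whether it has
changed. -/
def sortBody : Prog := .seq readBody (.seq writeBody countBody)

/-- Compute the parity of the number of moves in register `11`, then run `P`. -/
def parityProg (P : Prog) : Prog :=
  .seq (.const 1 1) <| .seq (.add 2 0 0) <| .seq (.add 2 2 1) <| .seq (.load 5 0) <|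
  .seq (.add 3 0 9) <| .seq (.const 4 0) <| .seq (.whilePos 3 linkBody) <|
  .seq (.sub 3 0 1) <| .seq (.const 4 0) <| .seq (.whilePos 3 sortBody) P

/-- The registers that are constant during the computation. -/
structure Ready (n : ℕ) (s : State) : Prop where
  zero : s.reg 0 = n
  one : s.reg 1 = 1
  two : s.reg 2 = 2 * n + 1
  nine : s.reg 9 = 0

/-- The memory holds a table of `B` at the cell `2 * n + 1 + x`. -/
def Table (n : ℕ) (B : Equiv.Perm ℤ) (s : State) (x : ℤ) : Prop :=
  s.mem (2 * n + 1 + x).toNat = B x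

/-- The state before the last `m` passes of the first loop. -/
structure LinkInv {n : ℕ} (α : SignedPerm n) (k m : ℕ) (s : State) : Prop extends Ready n s where
  add_eq : k + m = n
  three : s.reg 3 = m
  four : s.reg 4 = k
  eleven : s.reg 11 = 0
  five : k < n → s.reg 5 = α.word.formPerm⁻¹ (α.word.getD k 0)
  input : ∀ j < n, s.mem (j + 1) = α.word.getD j 0
  table : ∀ j < k, Table n (matching α.word.formPerm) s (α.word.formPerm⁻¹ (α.word.getD j 0)) ∧
    Table n (matching α.word.formPerm) s (-α.word.getD j 0)

theorem getD_mem {n : ℕ} (α : SignedPerm n) {j : ℕ} (hj : j < n) : α.word.getD j 0 ∈ α.word := by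
  rw [List.getD_eq_getElem _ _ (by rwa [α.length_word])]
  exact List.getElem_mem _

theorem formPerm_getD {n : ℕ} (α : SignedPerm n) {j : ℕ} (hj : j + 1 < n) :
    α.word.formPerm (α.word.getD j 0) = α.word.getD (j + 1) 0 := by
  have hl := α.length_word
  rw [List.getD_eq_getElem _ _ (by omega), List.getD_eq_getElem _ _ (by omega),
    List.formPerm_apply_lt_getElem _ α.admissible.nodup _ (by omega)]

theorem formPerm_getD_last {n : ℕ} (α : SignedPerm n) (hn : 0 < n) :
    α.word.formPerm (α.word.getD (n - 1) 0) = α.word.getD 0 0 := by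
  have hl := α.length_word
  have hw : α.word ≠ [] := by
    intro h
    rw [h] at hl
    simp at hl
    omega
  have := formPerm_getLast hw
  rw [List.getLast_eq_getElem, List.head_eq_getElem] at this
  rw [List.getD_eq_getElem _ _ (by omega), List.getD_eq_getElem _ _ (by omega), ← this]
  simp only [hl]

theorem formPerm_inv_mem {w : List ℤ} {x : ℤ} (h : x ∈ w) : w.formPerm⁻¹ x ∈ w := by
  rw [← List.formPerm_mem_iff_mem]
  simpa using h

theorem linkBody_runs {n : ℕ} (α : SignedPerm n) {k m : ℕ} {s : State} (hW : 4 * (n + 1) ≤ W)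
    (h : LinkInv α k (m + 1) s) : Runs W linkBody s 9 (LinkInv α (k + 1) m) := by
  obtain ⟨⟨h0, h1, h2, h9⟩, hkm, h3, h4, h11, h5, hin, ht⟩ := h
  have hk : k < n := by omega
  have hcm := getD_mem α hk
  have hpm := formPerm_inv_mem hcm
  have hin' := hin k hk
  have hnext : k + 1 < n → α.word.getD k 0 = α.word.formPerm⁻¹ (α.word.getD (k + 1) 0) := fun h =>
    Equiv.Perm.eq_inv_iff_eq.2 (formPerm_getD α h)
  have B1 : matching α.word.formPerm (-α.word.getD k 0) = α.word.formPerm⁻¹ (α.word.getD k 0) :=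
    α.admissible.matching_neg_mem hcm
  have B2 : matching α.word.formPerm (α.word.formPerm⁻¹ (α.word.getD k 0)) = -α.word.getD k 0 := by
    rw [← B1, matching_matching]
  have h5 := h5 hk
  have bc := α.bounds hcm
  have bp := α.bounds hpm
  have hb : ∀ j < k, (α.word.formPerm⁻¹ (α.word.getD j 0)).natAbs ≤ n ∧
      (α.word.getD j 0).natAbs ≤ n := fun j hj =>
    ⟨(α.bounds (formPerm_inv_mem (getD_mem α (hj.trans hk)))).2,
      (α.bounds (getD_mem α (hj.trans hk))).2⟩
  have e4 : ((k : ℤ) + 1).toNat = k + 1 := by omega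
  set c := α.word.getD k 0
  set p := α.word.formPerm⁻¹ c
  refine Runs.seq_one (runs_add ?_ (Runs.seq_one (runs_load ?_ (Runs.seq_one (runs_add ?_
    (Runs.seq_one (runs_sub ?_ (Runs.seq_one (runs_store ?_ (Runs.seq_one (runs_sub ?_
    (Runs.seq_one (runs_store ?_ (Runs.seq_one (runs_add ?_ (runs_sub ?_ ?_))))))))))))))))
  all_goals simp [setReg_reg, setReg_mem, setMem_reg, -List.getD_eq_getElem?_getD, h1, h2, h3, h4,
    h5, h9, e4, hin']
  pick_goal 10
  · refine ⟨⟨?_, ?_, ?_, ?_⟩, ?_, ?_, ?_, ?_, ?_, ?_, ?_⟩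
    all_goals try simp [setReg_reg, setReg_mem, setMem_reg, setMem_mem, Table,
      -List.getD_eq_getElem?_getD, h0, h1, h2, h9, h11]
    · omega
    · exact hnext
    -- The input occupies cells up to `n`, while table writes go to cells from `n + 1` on.
    · intro j hj
      rw [if_neg (by omega), if_neg (by omega)]
      exact hin j hj
    · intro j hj
      have key : ∀ x : ℤ, x.natAbs ≤ n → (x = p ∨ x = -c ∨ Table n (matching α.word.formPerm) s x) →
          (if (2 * (n : ℤ) + 1 + x).toNat = (2 * (n : ℤ) + 1 - c).toNat then p
            else if (2 * (n : ℤ) + 1 + x).toNat = (2 * (n : ℤ) + 1 + p).toNat then -c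
            else s.mem (2 * (n : ℤ) + 1 + x).toNat) = matching α.word.formPerm x := by
        intro x hx hx'
        by_cases hxc : x = -c
        · rw [if_pos (by rw [hxc]; rfl), hxc, B1]
        · rw [if_neg (by omega)]
          by_cases hxp : x = p
          · rw [if_pos (by rw [hxp]), hxp, B2]
          · rw [if_neg (by omega)]
            exact (hx'.resolve_left hxp).resolve_left hxc
      rcases Nat.le_iff_lt_or_eq.1 hj with hj | rfl
      · have := hb j hj
        exact ⟨key _ this.1 (.inr (.inr (ht j hj).1)),
          key _ (by omega) (.inr (.inr (ht j hj).2))⟩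
      · exact ⟨key _ bp.2 (.inl rfl), key _ (by omega) (.inr (.inl rfl))⟩
  all_goals first | omega | (rw [abs_le]; constructor <;> omega)

/-- The state before the last `m` passes of the second loop. -/
structure SortInv {n : ℕ} (α : SignedPerm n) (m : ℕ) (s : State) (i : ℕ) (B : Equiv.Perm ℤ)
    (e : ℕ) : Prop extends Ready n s where
  add_eq : i + m = n - 1
  three : s.reg 3 = (n : ℤ) - 1 - i
  four : s.reg 4 = i
  eleven : s.reg 11 = e
  le_one : e ≤ 1
  isMatching : IsMatching B
  bound : ∀ x : ℤ, x.natAbs ≤ n → (B x).natAbs ≤ n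
  table : ∀ x : ℤ, x ≠ 0 → x.natAbs ≤ n → Table n B s x
  even : Even (e + sortDist ((List.range' (i + 1) m).map Nat.cast) B + α.dist)

/-- The tests follow the reverse order of the four writes in `writeBody`, where a later write wins.
When `B u = v` the writes merely repeat old values, so the program needs no case distinction. -/
theorem recombine_apply_rev {u v : ℤ} {B : Equiv.Perm ℤ} (hB : IsMatching B) (hu : u ≠ 0)
    (hv : v ≠ 0) (huv : u ≠ v) (z : ℤ) : recombine u v B z =
      if z = B v then B u else if z = B u then B v else if z = v then u else
        if z = u then v else B z := by
  rw [recombine_apply hB hu hv huv]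
  have h1 := hB.invol u
  have h2 := hB.invol v
  have h3 : B u ≠ u := fun h => hu (hB.fix u h)
  have h4 : B v ≠ v := fun h => hv (hB.fix v h)
  have h5 : B u ≠ B v := fun h => huv (B.injective h)
  by_cases h : B u = v
  · have h' : B v = u := by rw [← h, h1]
    simp only [h, h']
  · have h' : B v ≠ u := fun e => h (by rw [← e, h2])
    split_ifs <;> simp_all

theorem readBody_runs {n : ℕ} {s : State} {i : ℤ} (hW : 4 * (n + 1) ≤ W) (h : Ready n s)
    (h4 : s.reg 4 = i) (hi : 0 ≤ i) (hi' : i + 1 ≤ n) : Runs W readBody s 7 fun s' =>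
      Ready n s' ∧ s'.mem = s.mem ∧ s'.reg 3 = s.reg 3 ∧ s'.reg 4 = i + 1 ∧
      s'.reg 5 = s.mem (2 * (n : ℤ) + 1 + (i + 1)).toNat ∧ s'.reg 6 = -1 + -(i + 1) ∧
      s'.reg 7 = 2 * (n : ℤ) + 1 + (i + 1) ∧ s'.reg 8 = 2 * (n : ℤ) - (i + 1) ∧
      s'.reg 10 = s.mem (2 * (n : ℤ) - (i + 1)).toNat ∧ s'.reg 11 = s.reg 11 := by
  obtain ⟨h0, h1, h2, h9⟩ := h
  refine Runs.seq_one (runs_add ?_ (Runs.seq_one (runs_add ?_ (Runs.seq_one (runs_load ?_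
    (Runs.seq_one (runs_add ?_ (Runs.seq_one (runs_sub ?_ (Runs.seq_one (runs_load ?_
    (runs_sub ?_ ?_))))))))))))
  pick_goal 8
  · refine ⟨⟨?_, ?_, ?_, ?_⟩, ?_⟩
    all_goals simp [setReg_reg, setReg_mem, h0, h1, h2, h4, h9]
  all_goals simp [setReg_reg, h1, h2, h4, h9]
  all_goals first | omega | (rw [abs_le]; constructor <;> omega)

theorem writeBody_runs {n : ℕ} {s : State} {u v a b : ℤ} (hW : 4 * (n + 1) ≤ W) (h : Ready n s)
    (h4 : s.reg 4 = u) (h5 : s.reg 5 = a) (h6 : s.reg 6 = v)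
    (h7 : s.reg 7 = 2 * (n : ℤ) + 1 + u) (h8 : s.reg 8 = 2 * (n : ℤ) - u) (h10 : s.reg 10 = b)
    (ha : a.natAbs ≤ n) (hb : b.natAbs ≤ n) (hu : 0 < u) (hu' : u ≤ n) :
    Runs W writeBody s 6 fun s' => Ready n s' ∧
      (∀ y, s'.mem y = if y = (2 * (n : ℤ) + 1 + b).toNat then a
        else if y = (2 * (n : ℤ) + 1 + a).toNat then b
        else if y = (2 * (n : ℤ) - u).toNat then u
        else if y = (2 * (n : ℤ) + 1 + u).toNat then v else s.mem y) ∧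
      s'.reg 3 = s.reg 3 ∧ s'.reg 5 = a ∧ s'.reg 4 = u ∧ s'.reg 6 = v ∧
      s'.reg 11 = s.reg 11 := by
  obtain ⟨h0, h1, h2, h9⟩ := h
  refine Runs.seq_one (runs_store ?_ (Runs.seq_one (runs_store ?_ (Runs.seq_one (runs_add ?_
    (Runs.seq_one (runs_store ?_ (Runs.seq_one (runs_add ?_ (runs_store ?_ ?_))))))))))
  pick_goal 7
  · refine ⟨⟨?_, ?_, ?_, ?_⟩, ?_⟩
    all_goals simp [setReg_reg, setReg_mem, setMem_reg, setMem_mem, h0, h1, h2, h4, h5, h6, h7,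
      h8, h9, h10]
  all_goals simp [setReg_reg, setMem_reg, h2, h5, h7, h8, h10]
  all_goals first | omega | (rw [abs_le]; constructor <;> omega)

theorem countBody_runs {n : ℕ} {s : State} {a v i : ℤ} {e : ℕ} (hW : 4 * (n + 1) ≤ W)
    (h : Ready n s) (h3 : s.reg 3 = i) (hi : i.natAbs ≤ n) (h5 : s.reg 5 = a) (h6 : s.reg 6 = v)
    (ha : a.natAbs ≤ n) (hv : v.natAbs ≤ n) (h11 : s.reg 11 = e) (he : e ≤ 1) :
    Runs W countBody s 6 fun s' => Ready n s' ∧ s'.mem = s.mem ∧ s'.reg 3 = i - 1 ∧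
      s'.reg 4 = s.reg 4 ∧ s'.reg 11 = (if a = v then e else 1 - e : ℕ) := by
  obtain ⟨h0, h1, h2, h9⟩ := h
  refine Runs.seq_one (runs_sub ?_ (Runs.seq_one (runs_sub ?_
    -- The short branch is padded to the three steps of the other one.
    (runs_ifPos (fun hlt => (runs_sub ?_ ?_).mono (by norm_num : 1 ≤ 3) fun _ h => h)
      fun hle => Runs.seq_one (runs_sub ?_ (runs_ifPos (fun hlt => runs_sub ?_ ?_)
        fun hle' => runs_const ?_ ?_))))))
  pick_goal 4
  · simp [setReg_reg, h1, h5, h6] at hlt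
    refine ⟨⟨?_, ?_, ?_, ?_⟩, ?_⟩
    all_goals simp [setReg_reg, setReg_mem, h0, h1, h2, h3, h9, h11]
    rw [if_neg (by omega)]
    omega
  pick_goal 6
  · simp [setReg_reg, h1, h5, h6, h9] at hlt
    refine ⟨⟨?_, ?_, ?_, ?_⟩, ?_⟩
    all_goals simp [setReg_reg, setReg_mem, h0, h1, h2, h3, h9, h11]
    rw [if_neg (by omega)]
    omega
  pick_goal 7
  · simp [setReg_reg, h1, h5, h6, h9] at hle hle'
    refine ⟨⟨?_, ?_, ?_, ?_⟩, ?_⟩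
    all_goals simp [setReg_reg, setReg_mem, h0, h1, h2, h3, h9, h11]
    omega
  all_goals simp [setReg_reg, h1, h3, h5, h6, h9, h11]
  all_goals first | omega | (rw [abs_le]; constructor <;> omega)

theorem sortBody_runs {n : ℕ} (α : SignedPerm n) {m : ℕ} {s : State} (hW : 4 * (n + 1) ≤ W)
    {i e : ℕ} {B : Equiv.Perm ℤ} (h : SortInv α (m + 1) s i B e) :
    Runs W sortBody s 19 fun s' => ∃ i B e, SortInv α m s' i B e := by
  obtain ⟨⟨h0, h1, h2, h9⟩, him, h3, h4, h11, he, hB, hb, ht, hev⟩ := h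
  have hsplit : sortDist ((List.range' (i + 1) (m + 1)).map Nat.cast) B =
      (if B (i + 1) = -1 + -(i + 1) then 0 else 1) +
        sortDist ((List.range' (i + 1 + 1) m).map Nat.cast)
          (recombine (i + 1) (-1 + -(i + 1)) B) := by
    rw [List.range'_succ, List.map_cons, sortDist]
    push_cast
    rw [show -((i : ℤ) + 1 + 1) = -1 + -(i + 1) by ring]
  rw [hsplit] at hev
  clear hsplit
  generalize hu : (i : ℤ) + 1 = u at *
  generalize hv : -1 + -u = v at *
  have ha := hb u (by omega)
  have hb' := hb v (by omega)
  have tu : s.mem (2 * (n : ℤ) + 1 + u).toNat = B u := ht u (by omega) (by omega)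
  have tv : s.mem (2 * (n : ℤ) - u).toNat = B v := by
    rw [← ht v (by omega) (by omega)]
    congr 2
    omega
  have hrec := recombine_apply_rev hB (u := u) (v := v) (by omega) (by omega) (by omega)
  have hB' : IsMatching (recombine u v B) := hB.recombine (by omega) (by omega) (by omega)
  have hbound : ∀ x : ℤ, x.natAbs ≤ n → (recombine u v B x).natAbs ≤ n := by
    intro x hx
    have := hb x hx
    rw [hrec]
    split_ifs <;> omega
  have htable : ∀ x : ℤ, x ≠ 0 → x.natAbs ≤ n →
      (if (2 * (n : ℤ) + 1 + x).toNat = (2 * (n : ℤ) + 1 + B v).toNat then B u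
        else if (2 * (n : ℤ) + 1 + x).toNat = (2 * (n : ℤ) + 1 + B u).toNat then B v
        else if (2 * (n : ℤ) + 1 + x).toNat = (2 * (n : ℤ) - u).toNat then u
        else if (2 * (n : ℤ) + 1 + x).toNat = (2 * (n : ℤ) + 1 + u).toNat then v
        else s.mem (2 * (n : ℤ) + 1 + x).toNat) = recombine u v B x := by
    -- Distinct labels have distinct cells, and `2 * n - u` is the cell of `v = -(u + 1)`.
    intro x hx0 hx
    have i1 : (2 * (n : ℤ) + 1 + x).toNat = (2 * (n : ℤ) + 1 + B v).toNat ↔ x = B v := by omega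
    have i2 : (2 * (n : ℤ) + 1 + x).toNat = (2 * (n : ℤ) + 1 + B u).toNat ↔ x = B u := by omega
    have i3 : (2 * (n : ℤ) + 1 + x).toNat = (2 * (n : ℤ) - u).toNat ↔ x = v := by omega
    have i4 : (2 * (n : ℤ) + 1 + x).toNat = (2 * (n : ℤ) + 1 + u).toNat ↔ x = u := by omega
    have hx' : s.mem (2 * (n : ℤ) + 1 + x).toNat = B x := ht x hx0 hx
    simp only [i1, i2, i3, i4, hx', hrec]
  have final : ∀ (s' : State) (e' : ℕ), Ready n s' → s'.reg 3 = s.reg 3 - 1 → s'.reg 4 = u →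
      s'.reg 11 = e' → (e' = if B u = v then e else 1 - e) →
      (∀ x : ℤ, x ≠ 0 → x.natAbs ≤ n → s'.mem (2 * (n : ℤ) + 1 + x).toNat = recombine u v B x) →
      ∃ i B e, SortInv α m s' i B e := by
    intro s' e' hr h3' h4' h11' he' hm
    refine ⟨i + 1, recombine u v B, e', hr, by omega, ?_, ?_, h11', ?_, hB', hbound, hm, ?_⟩
    · push_cast
      omega
    · push_cast
      omega
    · split_ifs at he' <;> omega
    -- A missing edge leaves the remaining count and toggles `e`, so the parity of the sum is kept.
    · rw [Nat.even_iff] at hev ⊢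
      split_ifs at he' hev <;> omega
  refine ((readBody_runs hW ⟨h0, h1, h2, h9⟩ h4 (by omega) (by omega)).mono le_rfl ?_).seq
    (T' := 12)
  rintro s₁ ⟨r₁, m₁, h3₁, h4₁, h5₁, h6₁, h7₁, h8₁, h10₁, h11₁⟩
  rw [hu] at h4₁ h5₁ h6₁ h7₁ h8₁ h10₁
  rw [tu] at h5₁
  rw [tv] at h10₁
  rw [hv] at h6₁
  refine ((writeBody_runs hW r₁ h4₁ h5₁ h6₁ h7₁ h8₁ h10₁ ha hb' (by omega) (by omega)).mono
    le_rfl ?_).seq (T' := 6)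
  rintro s₂ ⟨r₂, m₂, h3₂, h5₂, h4₂, h6₂, h11₂⟩
  refine (countBody_runs hW r₂ (i := s.reg 3) (by omega) (by omega) h5₂ h6₂ (by omega) (by omega)
    (h11₂.trans (h11₁.trans h11)) he).mono le_rfl ?_
  rintro s₃ ⟨r₃, m₃, h3₃, h4₃, h11₃⟩
  refine final s₃ (if B u = v then e else 1 - e) r₃ h3₃ (h4₃.trans h4₂) h11₃ rfl
    fun x hx0 hx => ?_
  rw [m₃, m₂, m₁]
  exact htable x hx0 hx

end RAM

-- Correctness and running time of the whole program.

theorem SignedPerm.mem_or_mem_neg {n : ℕ} (α : SignedPerm n) {x : ℤ} (h0 : x ≠ 0)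
    (hx : x.natAbs ≤ n) : x ∈ α.word ∨ -x ∈ α.word := by
  have := α.mem_or_mem (i := x.natAbs) (by omega) (by omega)
  rcases Int.natAbs_eq x with h | h
  · rwa [← h] at this
  · rw [← h, show (x.natAbs : ℤ) = -x by omega] at this
    exact this.symm

theorem natAbs_matching_le {n : ℕ} (α : SignedPerm n) {x : ℤ} (hx : x.natAbs ≤ n) :
    (matching α.word.formPerm x).natAbs ≤ n := by
  by_cases h0 : x = 0
  · rw [h0, α.admissible.isMatching.zero]
    simp
  rcases α.mem_or_mem_neg h0 hx with h | h
  · rw [α.admissible.matching_mem h, Int.natAbs_neg]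
    exact (α.bounds (List.formPerm_apply_mem_of_mem h)).2
  · have e := α.admissible.matching_neg_mem h
    rw [neg_neg] at e
    rw [e]
    refine (α.bounds ?_).2
    rw [← List.formPerm_mem_iff_mem]
    simpa using h

namespace RAM

theorem exists_getD {n : ℕ} (α : SignedPerm n) {x : ℤ} (hx : x ∈ α.word) :
    ∃ j < n, α.word.getD j 0 = x := by
  obtain ⟨j, hj, e⟩ := List.getElem_of_mem hx
  exact ⟨j, by rwa [α.length_word] at hj, by rw [List.getD_eq_getElem _ _ hj, e]⟩

theorem parityProg_runs {n : ℕ} (α : SignedPerm n) {P : Prog} {W : ℕ} {T : ℕ} {R : State → Prop}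
    (hW : 4 * (n + 1) ≤ W) (hP : ∀ (s : State) (e : ℕ), Ready n s → s.reg 11 = e → e ≤ 1 →
      Even (e + α.dist) → Runs W P s T R) :
    Runs W (parityProg P) (input α) (30 * (n + 1) + T) R := by
  have h0 : (input α).reg 0 = n := rfl
  have h1 : ∀ x, x ≠ 0 → (input α).reg x = 0 := fun x hx => if_neg hx
  have hm : ∀ j, (input α).mem (j + 1) = α.word.getD j 0 := fun j => by simp [input]
  have hpre : Runs W (parityProg P) (input α)
      (T + (((n - 1) * (19 + 1) + 1) + 1 + 1 + (n * (9 + 1) + 1)) + 1 + 1 + 1 + 1 + 1 + 1) R := by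
    refine Runs.seq_one (runs_const ?_ (Runs.seq_one (runs_add ?_ (Runs.seq_one (runs_add ?_
      (Runs.seq_one (runs_load ?_ (Runs.seq_one (runs_add ?_ (Runs.seq_one
        (runs_const ?_ ?_)))))))))))
    pick_goal 7
    · rw [add_comm T, add_comm _ (n * _ + 1), add_assoc (n * _ + 1)]
      refine Runs.seq ?_
      refine (runs_whilePos (I := fun m s => ∃ k, LinkInv α k m s) (m := n) ?_ ?_ ?_).mono le_rfl ?_
      · rintro s ⟨k, h⟩
        rw [h.three]
        simp
      · rintro m s ⟨k, h⟩
        refine ⟨?_, (linkBody_runs α hW h).mono le_rfl fun s h => ⟨_, h⟩⟩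
        rw [h.three]
        positivity
      · refine ⟨0, ⟨⟨?_, ?_, ?_, ?_⟩, ?_, ?_, ?_, ?_, ?_, ?_, ?_⟩⟩
        all_goals try simp [setReg_reg, setReg_mem, h0, h1, hm, -List.getD_eq_getElem?_getD]
        · ring
        -- Register `5` starts with the last entry, the cyclic predecessor of the first.
        · intro hn
          rw [← formPerm_getD_last α hn]
          obtain ⟨m, rfl⟩ : ∃ m, n = m + 1 := ⟨n - 1, by omega⟩
          rw [hm]
          simp
      · rintro s ⟨k, hk⟩
        obtain rfl : k = n := hk.add_eq
        rw [show (k - 1) * (19 + 1) + 1 + 1 + 1 + T = ((k - 1) * (19 + 1) + 1 + T) + 1 + 1 by ring]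
        have hr := hk.toReady
        refine Runs.seq_one (runs_sub ?_ (Runs.seq_one (runs_const ?_ (Runs.seq ?_))))
        · rw [hr.zero, hr.one, abs_le]
          constructor <;> omega
        · simp
        refine (runs_whilePos (I := fun m s => ∃ i B e, SortInv α m s i B e) ?_ ?_ ?_).mono
          le_rfl ?_
        -- For `n = 0` the loop register holds `-1` although no passes are left; the test only asks
        -- that it is not positive.
        · rintro s ⟨i, B, e, h⟩
          rw [h.three]
          have := h.add_eq
          omega
        · rintro m s ⟨i, B, e, h⟩
          refine ⟨?_, sortBody_runs α hW h⟩
          rw [h.three]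
          have := h.add_eq
          omega
        · refine ⟨0, matching α.word.formPerm, 0, ⟨⟨?_, ?_, ?_, ?_⟩, ?_, ?_, ?_, ?_, ?_,
            α.admissible.isMatching, ?_, ?_, ?_⟩⟩
          all_goals try simp [setReg_reg, hr.zero, hr.one, hr.two, hr.nine, hk.eleven]
          · exact fun x hx => natAbs_matching_le α hx
          · intro x hx0 hx
            rw [Table, setReg_mem, setReg_mem]
            -- Every label is an end of a tabulated edge: an entry `x` precedes its successor, and a
            -- label `x` with `-x` an entry is the left side of that entry.
            rcases α.mem_or_mem_neg hx0 hx with hm | hm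
            · obtain ⟨j, hj, e⟩ := exists_getD α (List.formPerm_apply_mem_of_mem hm)
              have := (hk.table j hj).1
              rw [e, Equiv.Perm.inv_def, Equiv.symm_apply_apply] at this
              exact this
            · obtain ⟨j, hj, e⟩ := exists_getD α hm
              have := (hk.table j hj).2
              rw [e, neg_neg] at this
              exact this
          -- Initially `e = 0` and everything remains to be counted, so the sum is `dist + dist`.
          · rw [SignedPerm.dist, pointerList]
            exact ⟨_, rfl⟩
        · rintro s ⟨i, B, e, h⟩
          have := h.even
          simp [sortDist] at this
          exact hP s e h.toReady h.eleven h.le_one this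
    all_goals simp [setReg_reg, h0, h1]
    all_goals first | omega | (rw [abs_le]; constructor <;> omega)
  refine hpre.mono ?_ fun _ h => h
  omega

theorem linearTimeDecidable_of_dist {Q : ∀ n : ℕ, SignedPerm n → Prop} {P : Prog}
    (hP : ∀ (n : ℕ) (α : SignedPerm n) (W : ℕ) (s : State) (e : ℕ), 4 * (n + 1) ≤ W →
      Ready n s → s.reg 11 = e → e ≤ 1 → Even (e + α.dist) →
      Runs W P s 1 fun s' => Q n α ∧ s'.reg 0 = 1 ∨ ¬ Q n α ∧ s'.reg 0 = 0) :
    LinearTimeDecidable Q := by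
  -- The computation of the parity takes at most `30 * (n + 1)` steps, and the final instruction one
  -- more.
  refine ⟨parityProg P, 31, fun n α => ?_⟩
  obtain ⟨t, s, h1, h2, h3⟩ := parityProg_runs α (W := 31 * (n + 1)) (by omega) fun s e =>
    hP n α (31 * (n + 1)) s e (by omega)
  exact ⟨t, s, h1, by omega, h3⟩

theorem linearTimeDecidable_odd_dist : LinearTimeDecidable fun _ α => Odd α.dist := by
  refine linearTimeDecidable_of_dist (P := .add 0 11 9) fun n α W s e hW hr h he hev =>
    runs_add ?_ ?_
  · rw [h, hr.nine, abs_le]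
    constructor <;> omega
  · rw [setReg_reg, if_pos rfl, h, hr.nine]
    rw [Nat.odd_iff]
    rw [Nat.even_iff] at hev
    omega

theorem linearTimeDecidable_even_dist : LinearTimeDecidable fun _ α => Even α.dist := by
  refine linearTimeDecidable_of_dist (P := .sub 0 1 11) fun n α W s e hW hr h he hev =>
    runs_sub ?_ ?_
  · rw [h, hr.one, abs_le]
    constructor <;> omega
  · rw [setReg_reg, if_pos rfl, h, hr.one]
    rw [Nat.even_iff] at hev ⊢
    omega

end RAM

theorem theorem11 :
    -- All maximal sequences of cdr moves have lengths of the same parity.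
    (∀ (n : ℕ) (α : SignedPerm n) (ps qs : List (Pointer n)),
      α.IsMaximalCdrSeq ps → α.IsMaximalCdrSeq qs → (Even ps.length ↔ Even qs.length)) ∧
    -- The games can be played out, in at most n - 1 moves, and any single play tells the winner.
    (∀ (n : ℕ) (α : SignedPerm n),
      (∃ ps : List (Pointer n), α.IsMaximalCdrSeq ps) ∧
      ∀ ps : List (Pointer n), α.IsMaximalCdrSeq ps →
        ps.length ≤ n - 1 ∧
        (α.OneWinsNormal ↔ Odd ps.length) ∧ (α.TwoWinsNormal ↔ Even ps.length) ∧
        (α.OneWinsMisere ↔ Even ps.length) ∧ (α.TwoWinsMisere ↔ Odd ps.length)) ∧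
    -- Both decision problems are decidable in linear time.
    RAM.LinearTimeDecidable (fun _ α => α.OneWinsNormal) ∧
    RAM.LinearTimeDecidable (fun _ α => α.OneWinsMisere) := by
  refine ⟨fun n α ps qs hp hq => by rw [α.even_length_iff hp, α.even_length_iff hq],
    fun n α => ⟨α.exists_isMaximalCdrSeq, fun ps hp => ?_⟩, ?_, ?_⟩
  · have he := α.even_length_iff hp
    have ho : Odd ps.length ↔ Odd α.dist := by
      rw [← Nat.not_even_iff_odd, ← Nat.not_even_iff_odd, he]
    obtain ⟨m, -, e⟩ := α.dist_eq_of_isMaximalCdrSeq ps hp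
    rw [he, ho]
    exact ⟨by have := α.dist_le; omega, α.normal_iff.1, α.normal_iff.2, α.misere_iff.1,
      α.misere_iff.2⟩
  · have : (fun n (α : SignedPerm n) => α.OneWinsNormal) = fun n α => Odd α.dist := by
      funext n α
      exact propext α.normal_iff.1
    rw [this]
    exact RAM.linearTimeDecidable_odd_dist
  · have : (fun n (α : SignedPerm n) => α.OneWinsMisere) = fun n α => Even α.dist := by
      funext n α
      exact propext α.misere_iff.1
    rw [this]
    exact RAM.linearTimeDecidable_even_dist
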